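/- Let $Q:\mathbb C\to\mathbb R$, $Q(z)=\sum_{j+k\le m}a_{jk}z^j\bar z^k$, be a nonzero real-valued subharmonic polynomial of degree $m$ without harmonic terms (that is, $a_{j0}=a_{0k}=0$ for all $j,k$; in particular $Q(0)=0$). Put $r=r_Q$, $r_Q(z,w)=\operatorname{Re}w+Q(z)$, and $\Omega_Q=\{(z,w)\in\mathbb C^2: r_Q(z,w)<0\}$. Let $L_r=\frac{\partial}{\partial z}-\big(\frac{\partial r}{\partial w}\big)^{-1}\frac{\partial r}{\partial z}\frac{\partial}{\partial w}$ and $N=\frac{\partial}{\partial w}$. For $j,k>0$ let $\mathscr L^{j,k}_r$ be the function obtained from the Levi form value $\mathscr L_r(L_r,\bar L_r)$ (where $\mathscr L_r(X,\bar Y)=\sum_{i,l}\frac{\partial^2 r}{\partial z_i\partial\bar z_l}X_i\bar Y_l$ with $(z_1,z_2)=(z,w)$) by applying $k-1$ times $\bar L_r$ and then $j-1$ times $L_r$, and let $C^r_l(p)=\max\{|\mathscr L^{j,k}_r(p)|: j,k>0,\ j+k=l\}$. The Catlin metric on $\Omega_Q$ is $$M_{r}(p,aL_r+bN)=\frac{|b|}{|r(p)|}+|a|\sum_{l=2}^{m}\Big(\frac{C_l^r(p)}{|r(p)|}\Big)^{1/l};$$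 explicitly, for $p=(z,w)$ and $v=(x,y)$, $$M_{r_Q}(p,v)=\frac{|y+2x\,\frac{\partial Q}{\partial z}(z)|}{|r_Q(p)|}+|x|\sum_{l=2}^m\Big(\frac{\max\{|\frac{\partial^{l}Q}{\partial z^j\partial\bar z^k}(z)|: j,k>0,\,j+k=l\}}{|r_Q(p)|}\Big)^{1/l}.$$ Let $d^C_{r_Q}(p,q)$ be the infimum of $\int_0^1M_{r_Q}(\gamma(t),\gamma'(t))\,dt$ over all piecewise $\mathcal C^1$ curves $\gamma:[0,1]\to\Omega_Q$ with $\gamma(0)=p$, $\gamma(1)=q$. Then $d^C_{r_Q}$ is a (finite) metric on $\Omega_Q$, and $(\Omega_Q,d^C_{r_Q})$ is Gromov hyperbolic: it is a proper geodesic metric space, and there is $\delta\ge0$ such that every point on any side of any geodesic triangle is within distance $\delta$ of the union of the other two sides. -/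

import Mathlib

open scoped ENNReal NNReal ComplexConjugate

noncomputable section

namespace CatlinModel

/-! Points of `ℂ²` are pairs `(z, w) : ℂ × ℂ`. -/

/-- The Wirtinger derivative `∂f/∂z` of `f : ℂ² → ℂ`. -/
def dz (f : ℂ × ℂ → ℂ) (p : ℂ × ℂ) : ℂ :=
  (1 / 2) * (fderiv ℝ f p (1, 0) - Complex.I * fderiv ℝ f p (Complex.I, 0))

/-- The Wirtinger derivative `∂f/∂z̄`. -/
def dzbar (f : ℂ × ℂ → ℂ) (p : ℂ × ℂ) : ℂ :=
  (1 / 2) * (fderiv ℝ f p (1, 0) + Complex.I * fderiv ℝ f p (Complex.I, 0))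

/-- The Wirtinger derivative `∂f/∂w`. -/
def dw (f : ℂ × ℂ → ℂ) (p : ℂ × ℂ) : ℂ :=
  (1 / 2) * (fderiv ℝ f p (0, 1) - Complex.I * fderiv ℝ f p (0, Complex.I))

/-- The Wirtinger derivative `∂f/∂w̄`. -/
def dwbar (f : ℂ × ℂ → ℂ) (p : ℂ × ℂ) : ℂ :=
  (1 / 2) * (fderiv ℝ f p (0, 1) + Complex.I * fderiv ℝ f p (0, Complex.I))

/-- The function `(∂r/∂w)⁻¹ ∂r/∂z`, meant for points where `∂r/∂w ≠ 0`. -/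
def tangentSlope (r : ℂ × ℂ → ℝ) (p : ℂ × ℂ) : ℂ :=
  (dw (fun q => (r q : ℂ)) p)⁻¹ * dz (fun q => (r q : ℂ)) p

/-- The complex tangential vector field `L_r = ∂/∂z - (∂r/∂w)⁻¹ (∂r/∂z) ∂/∂w`, acting on
functions. -/
def opL (r : ℂ × ℂ → ℝ) (f : ℂ × ℂ → ℂ) (p : ℂ × ℂ) : ℂ :=
  dz f p - tangentSlope r p * dw f p

/-- The conjugate vector field of `L_r`, acting on functions. -/
def opLbar (r : ℂ × ℂ → ℝ) (f : ℂ × ℂ → ℂ) (p : ℂ × ℂ) : ℂ :=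
  dzbar f p - conj (tangentSlope r p) * dwbar f p

/-- The Levi form `∑ (∂²r / ∂zᵢ ∂z̄ⱼ)(p) Xᵢ conj(Yⱼ)`, evaluated on `X` and the conjugate of `Y`. -/
def leviForm (r : ℂ × ℂ → ℝ) (p X Y : ℂ × ℂ) : ℂ :=
  dz (dzbar fun q => (r q : ℂ)) p * X.1 * conj Y.1 +
  dz (dwbar fun q => (r q : ℂ)) p * X.1 * conj Y.2 +
  dw (dzbar fun q => (r q : ℂ)) p * X.2 * conj Y.1 +
  dw (dwbar fun q => (r q : ℂ)) p * X.2 * conj Y.2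

/-- For `j, k > 0`: the Levi form of `r` on `(L_r, conj L_r)`, differentiated `k - 1` times along
`conj L_r` and then `j - 1` times along `L_r`. -/
def leviDeriv (r : ℂ × ℂ → ℝ) (j k : ℕ) : ℂ × ℂ → ℂ :=
  (opL r)^[j - 1] ((opLbar r)^[k - 1] fun p => leviForm r p (1, -tangentSlope r p) (1, -tangentSlope r p))

/-- `C_l(p) = max { |leviDeriv r j k p| : j, k > 0, j + k = l }` (for `l ≥ 2`). -/
def leviMax (r : ℂ × ℂ → ℝ) (l : ℕ) (p : ℂ × ℂ) : ℝ :=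
  (((Finset.HasAntidiagonal.antidiagonal l).filter fun jk => 0 < jk.1 ∧ 0 < jk.2).sup
    fun jk => ‖leviDeriv r jk.1 jk.2 p‖₊ : ℝ≥0)

/-- The Catlin metric `|b| / |r(p)| + |a| ∑_{l=2}^m (C_l(p) / |r(p)|)^{1/l}` at `p` of the vector
`v = a L_r + b ∂/∂w`; that is, `a = v.1` and `b = v.2 + tangentSlope r p * v.1`. -/
def catlinMetric (r : ℂ × ℂ → ℝ) (m : ℕ) (p v : ℂ × ℂ) : ℝ :=
  ‖v.2 + tangentSlope r p * v.1‖ / |r p| +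
    ‖v.1‖ * ∑ l ∈ Finset.Icc 2 m, (leviMax r l p / |r p|) ^ (1 / (l : ℝ))

/-- `γ` is a piecewise `C¹` curve on `[0, 1]` (continuity follows, as adjacent closed pieces
overlap at the break points). -/
def IsPiecewiseC1 (γ : ℝ → ℂ × ℂ) : Prop :=
  ∃ (n : ℕ) (t : ℕ → ℝ), Monotone t ∧ t 0 = 0 ∧ t n = 1 ∧
    ∀ i < n, ContDiffOn ℝ 1 γ (Set.Icc (t i) (t (i + 1)))

/-- The distance on `Ω` induced by a Finsler metric `F`: the infimum of the `F`-lengths of the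
piecewise `C¹` curves in `Ω` from `p` to `q` (`∞` if there is none of finite length). -/
def finslerEDist (Ω : Set (ℂ × ℂ)) (F : ℂ × ℂ → ℂ × ℂ → ℝ) (p q : ℂ × ℂ) : ℝ≥0∞ :=
  ⨅ (γ : ℝ → ℂ × ℂ) (_ : IsPiecewiseC1 γ ∧ (∀ t ∈ Set.Icc (0 : ℝ) 1, γ t ∈ Ω) ∧
      γ 0 = p ∧ γ 1 = q),
    ∫⁻ t in Set.Icc (0 : ℝ) 1, ENNReal.ofReal (F (γ t) (deriv γ t))

/-- A continuous subharmonic function on `ℂ` (sub-mean value property on all circles). -/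
def IsSubharmonic (f : ℂ → ℝ) : Prop :=
  Continuous f ∧ ∀ (c : ℂ) (R : ℝ), 0 < R → f c ≤ Real.circleAverage f c R

/-- `Q(z) = ∑ a_{jk} z^j z̄^k` is a real-valued subharmonic polynomial without harmonic terms
(`a_{j0} = a_{0k} = 0`) and with `Q(0) = 0`; `p` is the polynomial with coefficients `a_{jk}`,
in which variable `0` stands for `z` and variable `1` for `z̄`. -/
structure IsModelPolynomial (Q : ℂ → ℝ) (p : MvPolynomial (Fin 2) ℂ) : Prop where
  eval_eq : ∀ z : ℂ, (Q z : ℂ) = MvPolynomial.eval ![z, conj z] p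
  no_harmonic : ∀ s : Fin 2 →₀ ℕ, s 0 = 0 ∨ s 1 = 0 → p.coeff s = 0
  zero_eq : Q 0 = 0
  subharmonic : IsSubharmonic Q

/-- The defining function `r_Q(z, w) = Re w + Q(z)`. -/
def modelFun (Q : ℂ → ℝ) (p : ℂ × ℂ) : ℝ := p.2.re + Q p.1

/-- The model domain `Ω_Q = {Re w + Q(z) < 0}`. -/
def modelDomain (Q : ℂ → ℝ) : Set (ℂ × ℂ) := {p | modelFun Q p < 0}

/-- `S` is (the image of) a geodesic segment from `x` to `y`. -/
def IsGeodesicSegment {X : Type*} [MetricSpace X] (x y : X) (S : Set X) : Prop :=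
  ∃ (a b : ℝ) (σ : ℝ → X), a ≤ b ∧
    (∀ s ∈ Set.Icc a b, ∀ t ∈ Set.Icc a b, dist (σ s) (σ t) = |t - s|) ∧
    σ a = x ∧ σ b = y ∧ S = σ '' Set.Icc a b

/-- A Gromov hyperbolic space: a proper geodesic metric space in which, for some `δ ≥ 0`, every
point on a side of a geodesic triangle is within distance `δ` of the other two sides. (Relabelling
the vertices cyclically, one side suffices.) -/
def IsGromovHyperbolic (X : Type*) [MetricSpace X] : Prop :=
  ProperSpace X ∧
  (∀ x y : X, ∃ S, IsGeodesicSegment x y S) ∧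
  ∃ δ : ℝ, 0 ≤ δ ∧ ∀ (x y z : X) (S₁ S₂ S₃ : Set X),
    IsGeodesicSegment x y S₁ → IsGeodesicSegment y z S₂ → IsGeodesicSegment z x S₃ →
    ∀ u ∈ S₁, ∃ v ∈ S₂ ∪ S₃, dist u v ≤ δ

end CatlinModel

end

/-! Write `h = -r` for the height of a point and `m` for the degree. Two features of the Catlin
metric give hyperbolicity. First, `log h` is 1-Lipschitz, and vertical lines realise the difference
of `log h` as length (`abs_log_height_sub_le`, `finslerEDist_raise_le`). Second, raising a curve
vertically to a level `T` above it shortens it: the normal term shrinks by `h/T` and the order `l`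
term by `(h/T)^(1/l)`, and each factor is at most `(h/T)^(1/m)` (`levelMetric_le`). So the
pseudodistances `E τ` of the level sets `{log h = τ}` contract exponentially in `τ` at rate `1/m`,
as horospheres do in hyperbolic space. `LevelFamily` is the abstract form of this.

Let `L(x,y)` be half the sum of the distance and the two log-heights; it is the log-height at which
vertical lines from `x` and `y` effectively meet. Cutting a geodesic into unit pieces and summing a
geometric series shows that `E τ x y ≤ 1` once `τ ≥ L(x,y) + K` (`LevelFamily.exists_le_one`).
Conversely, going up to level `τ`, across and down bounds the distance by `E τ`. With the triangle
inequality for `E τ`, this makes `L` an ultrametric up to an additive constant. The four point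
condition follows (`LevelFamily.fourPoint`), and thin triangles follow from it.

Positivity, properness and geodesics rest on `exists_le_mixedMax`: a monomial of top degree is not
harmonic, so one mixed derivative of order `m` is a nonzero constant. Hence the metric dominates a
multiple of the Euclidean one along curves of bounded length from a given point. Balls are then
compact, and geodesics are limits of nearly shortest curves. -/

namespace CatlinModel

open MeasureTheory Set Filter Topology

/-! ### Piecewise `C¹` curves on arbitrary intervals -/

section Paths

variable {E G : Type*} [NormedAddCommGroup E] [NormedSpace ℝ E] [NormedAddCommGroup G]
  [NormedSpace ℝ G]

/-- `γ` is piecewise `C¹` on the interval from `a` to `b`. -/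
inductive PC1 (γ : ℝ → E) (a : ℝ) : ℝ → Prop
  | refl : PC1 γ a a
  | snoc {b c : ℝ} : PC1 γ a b → b ≤ c → ContDiffOn ℝ 1 γ (Icc b c) → PC1 γ a c

theorem PC1.le {γ : ℝ → E} {a b : ℝ} (h : PC1 γ a b) : a ≤ b := by
  induction h with
  | refl => exact le_rfl
  | snoc _ h _ ih => exact ih.trans h

theorem PC1.of_contDiffOn {γ : ℝ → E} {a b : ℝ} (hab : a ≤ b) (h : ContDiffOn ℝ 1 γ (Icc a b)) :
    PC1 γ a b := PC1.refl.snoc hab h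

theorem PC1.trans {γ : ℝ → E} {a b c : ℝ} (h : PC1 γ a b) (h' : PC1 γ b c) : PC1 γ a c := by
  induction h' with
  | refl => exact h
  | snoc _ hle hc ih => exact ih.snoc hle hc

theorem PC1.split {γ : ℝ → E} {a b c : ℝ} (h : PC1 γ a c) (hab : a ≤ b) (hbc : b ≤ c) :
    PC1 γ a b ∧ PC1 γ b c := by
  induction h with
  | refl => obtain rfl := le_antisymm hab hbc; exact ⟨.refl, .refl⟩
  | @snoc d e h hle hc ih =>
    rcases le_total b d with hbd | hbd
    · exact ⟨(ih hbd).1, (ih hbd).2.snoc hle hc⟩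
    · exact ⟨h.snoc hbd (hc.mono (Icc_subset_Icc_right hbc)),
        .of_contDiffOn hbc (hc.mono (Icc_subset_Icc_left hbd))⟩

theorem PC1.restrict {γ : ℝ → E} {a b c d : ℝ} (h : PC1 γ a d) (hab : a ≤ b) (hbc : b ≤ c)
    (hcd : c ≤ d) : PC1 γ b c :=
  ((h.split (hab.trans hbc) hcd).1.split hab hbc).2

theorem PC1.congr {γ γ' : ℝ → E} {a b : ℝ} (h : PC1 γ a b) (he : EqOn γ' γ (Icc a b)) :
    PC1 γ' a b := by
  induction h with
  | refl => exact .refl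
  | snoc h hle hc ih =>
    exact (ih (he.mono (Icc_subset_Icc_right hle))).snoc hle
      (hc.congr fun x hx => he (Icc_subset_Icc_left h.le hx))

theorem PC1.continuousOn {γ : ℝ → E} {a b : ℝ} (h : PC1 γ a b) : ContinuousOn γ (Icc a b) := by
  induction h with
  | refl => simp
  | snoc h hle hc ih =>
    rw [← Icc_union_Icc_eq_Icc h.le hle]
    exact ih.union_of_isClosed hc.continuousOn isClosed_Icc isClosed_Icc

theorem PC1.comp_left {γ : ℝ → E} {a b : ℝ} {f : E → G} {s : Set E} (h : PC1 γ a b)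
    (hf : ContDiffOn ℝ 1 f s) (hs : ∀ t ∈ Icc a b, γ t ∈ s) : PC1 (fun t => f (γ t)) a b := by
  induction h with
  | refl => exact .refl
  | snoc h hle hc ih =>
    exact (ih fun t ht => hs t (Icc_subset_Icc_right hle ht)).snoc hle
      (hf.comp hc fun t ht => hs t (Icc_subset_Icc_left h.le ht))

theorem PC1.comp_affine {γ : ℝ → E} {a b c d : ℝ} (hc : 0 < c) (h : PC1 γ (c * a + d) (c * b + d)) :
    PC1 (fun t => γ (c * t + d)) a b := by
  have key : ∀ e, PC1 γ (c * a + d) e → PC1 (fun t => γ (c * t + d)) a ((e - d) / c) := by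
    intro e he
    induction he with
    | refl => convert PC1.refl using 1; field_simp; ring
    | @snoc e f h hle hcd ih =>
      refine ih.snoc (by gcongr) (hcd.comp (by fun_prop) fun t ht => ?_)
      rw [mem_Icc, div_le_iff₀ hc, le_div_iff₀ hc] at ht
      constructor <;> nlinarith [ht.1, ht.2]
  convert key _ h using 1
  field_simp; ring

theorem PC1.reverse {γ : ℝ → E} {a b : ℝ} (h : PC1 γ a b) :
    PC1 (fun t => γ (a + b - t)) a b := by
  have key : ∀ c s, PC1 γ a c → PC1 (fun t => γ (s - t)) (s - c) (s - a) := by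
    intro c s hc
    induction hc with
    | refl => exact .refl
    | @snoc e f h hle hcd ih =>
      refine (PC1.of_contDiffOn (by linarith) (hcd.comp (by fun_prop) fun t ht => ?_)).trans ih
      rw [mem_Icc] at *
      constructor <;> linarith [ht.1, ht.2]
  convert key b (a + b) h using 1 <;> ring

theorem PC1.ae_differentiableAt {γ : ℝ → E} {a b : ℝ} (h : PC1 γ a b) :
    ∀ᵐ t, t ∈ Icc a b → DifferentiableAt ℝ γ t := by
  induction h with
  | refl =>
    filter_upwards [compl_mem_ae_iff.2 (measure_singleton (μ := volume) a)] with t ht h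
    simp at h ht
    exact absurd h ht
  | @snoc b c h hle hc ih =>
    filter_upwards [ih, compl_mem_ae_iff.2 (measure_singleton (μ := volume) b),
      compl_mem_ae_iff.2 (measure_singleton (μ := volume) c)] with t ht h1 h2 h3
    rcases le_or_gt t b with h4 | h4
    · exact ht ⟨h3.1, h4⟩
    · exact (hc.contDiffAt (Icc_mem_nhds h4 (lt_of_le_of_ne h3.2 h2))).differentiableAt (by simp)

theorem setLIntegral_Icc_add {f : ℝ → ℝ≥0∞} {a b c : ℝ} (hab : a ≤ b) (hbc : b ≤ c) :
    (∫⁻ t in Icc a b, f t) + ∫⁻ t in Icc b c, f t = ∫⁻ t in Icc a c, f t := by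
  rw [← Icc_union_Ioc_eq_Icc hab hbc, ← setLIntegral_congr (Ioc_ae_eq_Icc (a := b) (b := c)),
    lintegral_union measurableSet_Ioc]
  rw [Set.disjoint_left]
  intro x hx hx'
  exact absurd hx.2 (not_le.2 hx'.1)

theorem PC1.enorm_sub_le {γ : ℝ → E} {a b : ℝ} (h : PC1 γ a b) :
    ‖γ b - γ a‖ₑ ≤ ∫⁻ t in Icc a b, ‖deriv γ t‖ₑ := by
  induction h with
  | refl => simp
  | @snoc b c h hle hc ih =>
    rw [← setLIntegral_Icc_add h.le hle, ← sub_add_sub_cancel (γ c) (γ b) (γ a), add_comm]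
    exact (enorm_add_le _ _).trans (add_le_add ih
      (enorm_sub_le_lintegral_deriv_of_contDiffOn_Icc hc hle))

theorem IsPiecewiseC1.pc1 {γ : ℝ → ℂ × ℂ} (h : IsPiecewiseC1 γ) : PC1 γ 0 1 := by
  obtain ⟨n, t, hm, h0, h1, hc⟩ := h
  rw [← h0, ← h1]
  clear h1
  induction n with
  | zero => exact .refl
  | succ n ih =>
    exact (ih fun i hi => hc i (by omega)).snoc (hm (Nat.le_succ n)) (hc n (by omega))

theorem PC1.isPiecewiseC1 {γ : ℝ → ℂ × ℂ} (h : PC1 γ 0 1) : IsPiecewiseC1 γ := by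
  have key : ∀ b, PC1 γ 0 b → ∃ (n : ℕ) (t : ℕ → ℝ), Monotone t ∧ t 0 = 0 ∧ (∀ i ≥ n, t i = b) ∧
      ∀ i < n, ContDiffOn ℝ 1 γ (Icc (t i) (t (i + 1))) := by
    intro b hb
    induction hb with
    | refl => exact ⟨0, fun _ => 0, monotone_const, rfl, fun _ _ => rfl, by simp⟩
    | @snoc b c hb hle hc ih =>
      obtain ⟨n, t, hm, h0, h1, hcd⟩ := ih
      refine ⟨n + 1, fun i => if i ≤ n then t i else c, ?_, by simp [h0], ?_, ?_⟩
      · refine monotone_nat_of_le_succ fun i => ?_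
        rcases lt_trichotomy i n with h | h | h
        · simp [h.le, Nat.succ_le_iff.2 h, hm (Nat.le_succ i)]
        · simp [h, h1, hle]
        · simp [not_le.2 h, not_le.2 (h.trans (Nat.lt_succ_self i))]
      · intro i hi
        simp [not_le.2 (Nat.lt_of_succ_le hi)]
      · intro i hi
        rcases Nat.lt_succ_iff_lt_or_eq.1 hi with h | h
        · simpa [h.le, Nat.succ_le_iff.2 h] using hcd i h
        · simpa [h, h1] using hc
  obtain ⟨n, t, hm, h0, h1, hc⟩ := key 1 h
  exact ⟨n, t, hm, h0, h1 n le_rfl, hc⟩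

end Paths

/-! ### Finsler length and the induced pseudodistance -/

section Length

/-- The length of `γ` on `[a, b]` for the Finsler metric `F`. -/
noncomputable def pathLen (F : ℂ × ℂ → ℂ × ℂ → ℝ) (γ : ℝ → ℂ × ℂ) (a b : ℝ) : ℝ≥0∞ :=
  ∫⁻ t in Icc a b, ENNReal.ofReal (F (γ t) (deriv γ t))

variable {F : ℂ × ℂ → ℂ × ℂ → ℝ} {Ω : Set (ℂ × ℂ)} {γ : ℝ → ℂ × ℂ} {a b c : ℝ}

theorem pathLen_add (hab : a ≤ b) (hbc : b ≤ c) :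
    pathLen F γ a b + pathLen F γ b c = pathLen F γ a c :=
  setLIntegral_Icc_add hab hbc

theorem pathLen_self : pathLen F γ a a = 0 := by simp [pathLen]

theorem pathLen_congr {γ' : ℝ → ℂ × ℂ} (h : EqOn γ γ' (Ioo a b)) :
    pathLen F γ a b = pathLen F γ' a b := by
  unfold pathLen
  rw [← setLIntegral_congr (Ioo_ae_eq_Icc (a := a) (b := b)),
    ← setLIntegral_congr (Ioo_ae_eq_Icc (a := a) (b := b))]
  refine setLIntegral_congr_fun measurableSet_Ioo fun t ht => ?_
  have : γ =ᶠ[𝓝 t] γ' := Filter.eventuallyEq_of_mem (isOpen_Ioo.mem_nhds ht) h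
  simp only [this.deriv_eq, h ht]

/-- The factor `s` may be negative, so that the same change of variables serves rescaling and
reversal; hence the image interval is a hypothesis. -/
theorem pathLen_comp_affine (hF : ∀ p v (s : ℝ), F p (s • v) = |s| * F p v) {s d : ℝ} (hs : s ≠ 0)
    (h : (fun t => s * t + d) '' Icc a b = Icc c e) :
    pathLen F (fun t => γ (s * t + d)) a b = pathLen F γ c e := by
  unfold pathLen
  rw [← h, lintegral_image_eq_lintegral_abs_deriv_mul (f' := fun _ => s) measurableSet_Icc
    (fun x _ => by simpa using ((hasDerivAt_id x).const_mul s |>.add_const d).hasDerivWithinAt)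
    (fun x _ y _ hxy => by simpa [hs] using hxy)]
  refine lintegral_congr fun t => ?_
  have : deriv (fun t => γ (s * t + d)) t = s • deriv γ (s * t + d) := by
    have h1 := deriv_comp_mul_left s (fun x => γ (x + d)) t
    rw [deriv_comp_add_const] at h1
    exact h1
  rw [this, hF, ENNReal.ofReal_mul (abs_nonneg s)]

theorem finslerEDist_le_of_unit (h : PC1 γ 0 1) (hΩ : ∀ t ∈ Icc (0 : ℝ) 1, γ t ∈ Ω) :
    finslerEDist Ω F (γ 0) (γ 1) ≤ pathLen F γ 0 1 :=
  iInf₂_le_of_le γ ⟨h.isPiecewiseC1, hΩ, rfl, rfl⟩ le_rfl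

theorem finslerEDist_self (hF : ∀ p v (s : ℝ), F p (s • v) = |s| * F p v) {p : ℂ × ℂ} (hp : p ∈ Ω) :
    finslerEDist Ω F p p = 0 := by
  have h0 : F p 0 = 0 := by simpa using hF p 0 0
  have := finslerEDist_le_of_unit (F := F) (Ω := Ω) (γ := fun _ => p)
    (PC1.of_contDiffOn zero_le_one contDiffOn_const) (fun _ _ => hp)
  simpa [pathLen, h0] using this

theorem finslerEDist_le (hF : ∀ p v (s : ℝ), F p (s • v) = |s| * F p v) (h : PC1 γ a b)
    (hΩ : ∀ t ∈ Icc a b, γ t ∈ Ω) :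
    finslerEDist Ω F (γ a) (γ b) ≤ pathLen F γ a b := by
  rcases h.le.eq_or_lt with rfl | hab
  · rw [finslerEDist_self hF (hΩ a (by simp))]
    exact zero_le
  have hpos : 0 < b - a := sub_pos.2 hab
  have himg : (fun t => (b - a) * t + a) '' Icc 0 1 = Icc a b := by
    rw [Set.image_affine_Icc' hpos]
    simp
  have := finslerEDist_le_of_unit (F := F) (Ω := Ω) (γ := fun t => γ ((b - a) * t + a))
    (PC1.comp_affine hpos (by simpa using h)) (fun t ht => hΩ _ (himg ▸ mem_image_of_mem _ ht))
  rw [pathLen_comp_affine hF hpos.ne' himg] at this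
  simpa using this

theorem exists_path_of_finslerEDist_lt {p q : ℂ × ℂ} {c : ℝ≥0∞} (h : finslerEDist Ω F p q < c) :
    ∃ γ : ℝ → ℂ × ℂ, PC1 γ 0 1 ∧ (∀ t ∈ Icc (0 : ℝ) 1, γ t ∈ Ω) ∧ γ 0 = p ∧ γ 1 = q ∧
      pathLen F γ 0 1 < c := by
  obtain ⟨γ, hγ⟩ := iInf_lt_iff.1 h
  obtain ⟨⟨h1, h2, h3, h4⟩, h5⟩ := iInf_lt_iff.1 hγ
  exact ⟨γ, h1.pc1, h2, h3, h4, h5⟩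

theorem finslerEDist_symm_le (hF : ∀ p v (s : ℝ), F p (s • v) = |s| * F p v) (p q : ℂ × ℂ) :
    finslerEDist Ω F p q ≤ finslerEDist Ω F q p := by
  refine le_of_forall_gt fun c hc => ?_
  obtain ⟨γ, h1, h2, rfl, rfl, h5⟩ := exists_path_of_finslerEDist_lt hc
  have himg : (fun t : ℝ => (-1) * t + 1) '' Icc 0 1 = Icc 0 1 := by
    ext x; constructor
    · rintro ⟨y, hy, rfl⟩; constructor <;> linarith [hy.1, hy.2]
    · intro hx; exact ⟨1 - x, ⟨by linarith [hx.2], by linarith [hx.1]⟩, by ring⟩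
  have h3 : PC1 (fun t => γ ((-1) * t + 1)) 0 1 := by
    convert h1.reverse using 3; ring
  have := finslerEDist_le hF h3 (fun t ht => h2 _ (himg ▸ mem_image_of_mem _ ht))
  rw [pathLen_comp_affine hF (by norm_num) himg] at this
  simpa using this.trans_lt h5

theorem finslerEDist_comm (hF : ∀ p v (s : ℝ), F p (s • v) = |s| * F p v) (p q : ℂ × ℂ) :
    finslerEDist Ω F p q = finslerEDist Ω F q p :=
  le_antisymm (finslerEDist_symm_le hF p q) (finslerEDist_symm_le hF q p)

theorem finslerEDist_triangle (hF : ∀ p v (s : ℝ), F p (s • v) = |s| * F p v) (p q r : ℂ × ℂ) :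
    finslerEDist Ω F p r ≤ finslerEDist Ω F p q + finslerEDist Ω F q r := by
  refine le_of_forall_gt fun c hc => ?_
  obtain ⟨c1, c2, hc1, hc2, hcc⟩ : ∃ c1 c2, finslerEDist Ω F p q < c1 ∧ finslerEDist Ω F q r < c2 ∧
      c1 + c2 ≤ c := by
    obtain ⟨r, hr, h⟩ := ENNReal.lt_iff_exists_add_pos_lt.1 hc
    have hr2 : (0 : ℝ≥0∞) < ((r / 2 : ℝ≥0) : ℝ≥0∞) := by exact_mod_cast half_pos hr
    have hfin := (le_self_add.trans_lt h).ne_top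
    refine ⟨_, _, ENNReal.lt_add_right (ENNReal.add_ne_top.1 hfin).1 hr2.ne',
      ENNReal.lt_add_right (ENNReal.add_ne_top.1 hfin).2 hr2.ne', ?_⟩
    rw [add_add_add_comm, ← ENNReal.coe_add, add_halves]
    exact h.le
  obtain ⟨γ, h1, h2, rfl, rfl, h5⟩ := exists_path_of_finslerEDist_lt hc1
  obtain ⟨η, k1, k2, k3, rfl, k5⟩ := exists_path_of_finslerEDist_lt hc2
  have himg : (fun t : ℝ => 1 * t + (-1)) '' Icc 1 2 = Icc 0 1 := by
    rw [Set.image_affine_Icc' one_pos]; norm_num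
  set η' : ℝ → ℂ × ℂ := fun t => η (1 * t + (-1)) with hη'
  have hη1 : PC1 η' 1 2 := PC1.comp_affine one_pos (by norm_num; exact k1)
  set θ : ℝ → ℂ × ℂ := fun t => if t ≤ 1 then γ t else η' t with hθ
  have e1 : EqOn θ γ (Icc 0 1) := fun t ht => by simp [hθ, ht.2]
  have e2 : EqOn θ η' (Icc 1 2) := fun t ht => by
    rcases ht.1.eq_or_lt with rfl | h
    · simp [hθ, hη', k3]
    · simp [hθ, not_le.2 h]
  have h3 := finslerEDist_le (Ω := Ω) hF ((h1.congr e1).trans (hη1.congr e2)) (fun t ht => by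
    rcases le_total t 1 with h | h
    · rw [e1 ⟨ht.1, h⟩]; exact h2 t ⟨ht.1, h⟩
    · rw [e2 ⟨h, ht.2⟩]; exact k2 _ (himg ▸ mem_image_of_mem _ ⟨h, ht.2⟩))
  rw [← pathLen_add zero_le_one one_le_two, pathLen_congr (e1.mono Ioo_subset_Icc_self),
    pathLen_congr (e2.mono Ioo_subset_Icc_self), pathLen_comp_affine hF one_ne_zero himg,
    e1 ⟨le_rfl, zero_le_one⟩, e2 ⟨one_le_two, le_rfl⟩] at h3
  have : η' 2 = η 1 := by norm_num [hη']
  rw [this] at h3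
  exact h3.trans_lt ((ENNReal.add_lt_add h5 k5).trans_le hcc)

/-- Parametrisation of a curve of finite length proportionally to its length. -/
theorem exists_proportional_points (hL : pathLen F γ 0 1 ≠ ∞) :
    ∃ τ : ℝ → ℝ, τ 0 = 0 ∧ τ 1 = 1 ∧ ∀ x ∈ Icc (0 : ℝ) 1, τ x ∈ Icc (0 : ℝ) 1 ∧
      pathLen F γ 0 (τ x) = ENNReal.ofReal x * pathLen F γ 0 1 := by
  set φ : ℝ → ℝ≥0∞ := fun t => pathLen F γ 0 t with hφ
  have hcont : ContinuousOn φ (Icc 0 1) := by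
    intro t ht
    have hfin : pathLen F γ 0 t ≠ ∞ := ne_top_of_le_ne_top hL
      (by rw [← pathLen_add ht.1 ht.2]; exact le_self_add)
    refine (ENNReal.tendsto_nhds hfin).2 fun ε hε => ?_
    -- Absolute continuity of the integral: short parameter intervals carry little length, so the
    -- arc length function is continuous.
    obtain ⟨δ, hδ, hδ'⟩ := exists_pos_setLIntegral_lt_of_measure_lt (μ := volume.restrict (Icc 0 1)) hL hε.ne'
    obtain ⟨d, hd0, hd⟩ : ∃ d : ℝ, 0 < d ∧ ENNReal.ofReal d < δ := by
      obtain ⟨d, hd, hd'⟩ := ENNReal.lt_iff_exists_nnreal_btwn.1 hδ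
      exact ⟨d, by exact_mod_cast hd, by simpa using hd'⟩
    have hsmall : ∀ s u : ℝ, 0 ≤ s → s ≤ u → u ≤ 1 → u - s < d → pathLen F γ s u ≤ ε := by
      intro s u hs hsu hu hus
      have h1 := hδ' (Icc s u) (by
        refine (Measure.restrict_apply_le _ _).trans_lt ?_
        rw [Real.volume_Icc]
        exact (ENNReal.ofReal_le_ofReal hus.le).trans_lt hd)
      rw [Measure.restrict_restrict measurableSet_Icc,
        inter_eq_left.2 (Icc_subset_Icc hs hu)] at h1
      exact h1.le
    filter_upwards [self_mem_nhdsWithin, mem_nhdsWithin_of_mem_nhds (Metric.ball_mem_nhds t hd0)]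
      with s hs hst
    rw [Real.ball_eq_Ioo] at hst
    rcases le_total s t with h | h
    · have := hsmall s t hs.1 h ht.2 (by linarith [hst.1])
      have h2 := pathLen_add (F := F) (γ := γ) hs.1 h
      constructor
      · rw [tsub_le_iff_right]
        exact h2.symm.trans_le (by gcongr)
      · exact (le_self_add.trans_eq h2).trans le_self_add
    · have := hsmall t s ht.1 h hs.2 (by linarith [hst.2])
      have h2 := pathLen_add (F := F) (γ := γ) ht.1 h
      constructor
      · exact tsub_le_self.trans (le_self_add.trans_eq h2)
      · exact h2.symm.trans_le (by gcongr)
  have hivt : ∀ x : ℝ, ∃ t, x ∈ Icc (0 : ℝ) 1 → t ∈ Icc (0 : ℝ) 1 ∧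
      φ t = ENNReal.ofReal x * pathLen F γ 0 1 := by
    intro x
    by_cases hx : x ∈ Icc (0 : ℝ) 1
    · obtain ⟨t, ht, ht'⟩ := intermediate_value_Icc zero_le_one hcont
        (show ENNReal.ofReal x * pathLen F γ 0 1 ∈ Icc (φ 0) (φ 1) from
          ⟨by simp [hφ, pathLen_self],
            mul_le_of_le_one_left zero_le (by simpa using hx.2)⟩)
      exact ⟨t, fun _ => ⟨ht, ht'⟩⟩
    · exact ⟨0, fun h => absurd h hx⟩
  choose τ hτ using hivt
  -- Where the speed vanishes the parameter is not unique; the values at `0` and `1` are overwritten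
  -- to hit the endpoints exactly.
  refine ⟨fun x => if x = 0 then 0 else if x = 1 then 1 else τ x, by simp, by simp, fun x hx => ?_⟩
  rcases eq_or_ne x 0 with rfl | h0
  · simp [pathLen_self]
  rcases eq_or_ne x 1 with rfl | h1
  · simp
  simpa [h0, h1] using hτ x hx

theorem finslerEDist_le_of_proportional (hF : ∀ p v (s : ℝ), F p (s • v) = |s| * F p v)
    (h : PC1 γ 0 1) (hΩ : ∀ t ∈ Icc (0 : ℝ) 1, γ t ∈ Ω) (hL : pathLen F γ 0 1 ≠ ∞) {s t x y : ℝ}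
    (hs : s ∈ Icc (0 : ℝ) 1) (ht : t ∈ Icc (0 : ℝ) 1) (hx : x ∈ Icc (0 : ℝ) 1)
    (hs' : pathLen F γ 0 s = ENNReal.ofReal x * pathLen F γ 0 1)
    (ht' : pathLen F γ 0 t = ENNReal.ofReal y * pathLen F γ 0 1) (hxy : x ≤ y) :
    finslerEDist Ω F (γ s) (γ t) ≤ ENNReal.ofReal (y - x) * pathLen F γ 0 1 := by
  have hsub : ∀ u v : ℝ, u ∈ Icc (0 : ℝ) 1 → v ∈ Icc (0 : ℝ) 1 → u ≤ v →
      finslerEDist Ω F (γ u) (γ v) ≤ pathLen F γ u v := fun u v hu hv huv =>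
    finslerEDist_le hF (h.restrict hu.1 huv hv.2) fun z hz => hΩ z ⟨hu.1.trans hz.1, hz.2.trans hv.2⟩
  have hfin : ∀ x : ℝ, ENNReal.ofReal x * pathLen F γ 0 1 ≠ ∞ := fun x =>
    ENNReal.mul_ne_top ENNReal.ofReal_ne_top hL
  have hsplit : ENNReal.ofReal y * pathLen F γ 0 1 =
      ENNReal.ofReal x * pathLen F γ 0 1 + ENNReal.ofReal (y - x) * pathLen F γ 0 1 := by
    rw [← add_mul, ← ENNReal.ofReal_add hx.1 (sub_nonneg.2 hxy)]
    congr 2; ring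
  rcases le_total s t with hst | hst
  · refine (hsub s t hs ht hst).trans ?_
    have h1 := pathLen_add (F := F) (γ := γ) hs.1 hst
    rw [ht', hs', hsplit] at h1
    exact ((ENNReal.add_right_inj (hfin x)).1 h1).le
  · rw [finslerEDist_comm hF]
    refine (hsub t s ht hs hst).trans ?_
    have h1 := pathLen_add (F := F) (γ := γ) ht.1 hst
    rw [ht', hs', hsplit, add_assoc] at h1
    -- The chosen parameters need not be monotone. If they occur in the wrong order, the arc between
    -- them has length zero.
    have h2 : ENNReal.ofReal (y - x) * pathLen F γ 0 1 + pathLen F γ t s = 0 :=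
      (ENNReal.add_right_inj (hfin x)).1 (h1.trans (add_zero _).symm)
    rw [add_eq_zero] at h2
    rw [h2.2]; exact zero_le

end Length

end CatlinModel

/-! ### Wirtinger calculus of polynomials in `z` and `z̄`, and the Levi form of the model -/

namespace CatlinModel

open MvPolynomial

/-- The value at `(z, z̄)` of a polynomial in two variables. -/
noncomputable def evalConj (q : MvPolynomial (Fin 2) ℂ) (z : ℂ) : ℂ := eval ![z, conj z] q

/-- This is `dq = q_z dz + q_z̄ dz̄`; it turns Wirtinger derivatives into the formal `pderiv 0` and
`pderiv 1`. -/
theorem hasFDerivAt_evalConj (q : MvPolynomial (Fin 2) ℂ) (z : ℂ) :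
    HasFDerivAt (evalConj q)
      (evalConj (pderiv 0 q) z • ContinuousLinearMap.id ℝ ℂ +
        evalConj (pderiv 1 q) z • (Complex.conjCLE : ℂ →L[ℝ] ℂ)) z := by
  induction q using MvPolynomial.induction_on with
  | C a =>
    have h := hasFDerivAt_const (𝕜 := ℝ) a z
    refine (h.congr_of_eventuallyEq (.of_forall fun x => by simp [evalConj])).congr_fderiv ?_
    ext x; simp [evalConj]
  | add p q hp hq =>
    have h := hp.add hq
    refine (h.congr_of_eventuallyEq (.of_forall fun x => by simp [evalConj])).congr_fderiv ?_
    ext x; simp [evalConj]; ring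
  | mul_X p n hp =>
    have hn : HasFDerivAt (fun z : ℂ => (![z, conj z] : Fin 2 → ℂ) n)
        (if n = 0 then ContinuousLinearMap.id ℝ ℂ else (Complex.conjCLE : ℂ →L[ℝ] ℂ)) z := by
      fin_cases n
      · exact hasFDerivAt_id z
      · exact (Complex.conjCLE : ℂ →L[ℝ] ℂ).hasFDerivAt (x := z)
    have h := hp.mul hn
    refine (h.congr_of_eventuallyEq (.of_forall fun x => by simp [evalConj])).congr_fderiv ?_
    ext x
    fin_cases n <;> simp [evalConj, pderiv_X] <;> ring

theorem contDiff_evalConj (q : MvPolynomial (Fin 2) ℂ) : ContDiff ℝ 1 (evalConj q) := by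
  induction q using MvPolynomial.induction_on with
  | C a =>
    have h : evalConj (C a) = fun _ => a := by ext z; simp [evalConj]
    rw [h]; exact contDiff_const
  | add p q hp hq =>
    have h : evalConj (p + q) = fun z => evalConj p z + evalConj q z := by ext z; simp [evalConj]
    rw [h]; exact hp.add hq
  | mul_X p n hp =>
    have hn : ContDiff ℝ 1 (fun z : ℂ => (![z, conj z] : Fin 2 → ℂ) n) := by
      fin_cases n
      · exact contDiff_id
      · exact (Complex.conjCLE : ℂ →L[ℝ] ℂ).contDiff
    have h : evalConj (p * X n) = fun z => evalConj p z * (![z, conj z] : Fin 2 → ℂ) n := by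
      ext z; simp [evalConj]
    rw [h]; exact hp.mul hn

theorem hasFDerivAt_evalConj_fst (q : MvPolynomial (Fin 2) ℂ) (p : ℂ × ℂ) :
    HasFDerivAt (fun p : ℂ × ℂ => evalConj q p.1)
      ((evalConj (pderiv 0 q) p.1 • ContinuousLinearMap.id ℝ ℂ +
        evalConj (pderiv 1 q) p.1 • (Complex.conjCLE : ℂ →L[ℝ] ℂ)).comp
          (ContinuousLinearMap.fst ℝ ℂ ℂ)) p :=
  (hasFDerivAt_evalConj q p.1).comp p hasFDerivAt_fst

theorem dz_evalConj (q : MvPolynomial (Fin 2) ℂ) :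
    dz (fun p => evalConj q p.1) = fun p => evalConj (pderiv 0 q) p.1 := by
  ext p
  simp only [dz, (hasFDerivAt_evalConj_fst q p).fderiv]
  simp
  linear_combination (-1/2 * evalConj (pderiv 0 q) p.1 + 1/2 * evalConj (pderiv 1 q) p.1) * Complex.I_sq

theorem dzbar_evalConj (q : MvPolynomial (Fin 2) ℂ) :
    dzbar (fun p => evalConj q p.1) = fun p => evalConj (pderiv 1 q) p.1 := by
  ext p
  simp only [dzbar, (hasFDerivAt_evalConj_fst q p).fderiv]
  simp
  linear_combination (1/2 * evalConj (pderiv 0 q) p.1 - 1/2 * evalConj (pderiv 1 q) p.1) * Complex.I_sq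

theorem dw_evalConj (q : MvPolynomial (Fin 2) ℂ) : dw (fun p => evalConj q p.1) = 0 := by
  ext p
  simp [dw, (hasFDerivAt_evalConj_fst q p).fderiv]

theorem dwbar_evalConj (q : MvPolynomial (Fin 2) ℂ) : dwbar (fun p => evalConj q p.1) = 0 := by
  ext p
  simp [dwbar, (hasFDerivAt_evalConj_fst q p).fderiv]

/-- A function of `z` alone is killed by `∂/∂w`, so the slope in `L_r` plays no role. -/
theorem opL_evalConj (r : ℂ × ℂ → ℝ) (q : MvPolynomial (Fin 2) ℂ) :
    opL r (fun p => evalConj q p.1) = fun p => evalConj (pderiv 0 q) p.1 := by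
  ext p
  simp [opL, dz_evalConj, dw_evalConj]

theorem opLbar_evalConj (r : ℂ × ℂ → ℝ) (q : MvPolynomial (Fin 2) ℂ) :
    opLbar r (fun p => evalConj q p.1) = fun p => evalConj (pderiv 1 q) p.1 := by
  ext p
  simp [opLbar, dzbar_evalConj, dwbar_evalConj]

theorem iterate_opL_evalConj (r : ℂ × ℂ → ℝ) (n : ℕ) (q : MvPolynomial (Fin 2) ℂ) :
    (opL r)^[n] (fun p => evalConj q p.1) = fun p => evalConj ((pderiv 0)^[n] q) p.1 := by
  induction n generalizing q with
  | zero => rfl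
  | succ n ih => rw [Function.iterate_succ_apply, opL_evalConj, ih, Function.iterate_succ_apply]

theorem iterate_opLbar_evalConj (r : ℂ × ℂ → ℝ) (n : ℕ) (q : MvPolynomial (Fin 2) ℂ) :
    (opLbar r)^[n] (fun p => evalConj q p.1) = fun p => evalConj ((pderiv 1)^[n] q) p.1 := by
  induction n generalizing q with
  | zero => rfl
  | succ n ih => rw [Function.iterate_succ_apply, opLbar_evalConj, ih, Function.iterate_succ_apply]

/-- The mixed derivative `∂^{j+k} q / ∂z^j ∂z̄^k`, for `j, k > 0`. -/
noncomputable def mixedDeriv (q : MvPolynomial (Fin 2) ℂ) (j k : ℕ) : MvPolynomial (Fin 2) ℂ :=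
  (pderiv 0)^[j - 1] ((pderiv 1)^[k - 1] (pderiv 0 (pderiv 1 q)))

section Model

variable {Q : ℂ → ℝ} {p : MvPolynomial (Fin 2) ℂ} (hQ : ∀ z, (Q z : ℂ) = evalConj p z)
include hQ

theorem ofReal_modelFun_eq :
    (fun q => (modelFun Q q : ℂ)) = fun q : ℂ × ℂ => (q.2.re : ℂ) + evalConj p q.1 := by
  ext q
  simp [modelFun, hQ]

theorem hasFDerivAt_ofReal_modelFun (q : ℂ × ℂ) :
    HasFDerivAt (fun q => (modelFun Q q : ℂ))
      ((Complex.ofRealCLM.comp Complex.reCLM).comp (ContinuousLinearMap.snd ℝ ℂ ℂ) +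
        (evalConj (pderiv 0 p) q.1 • ContinuousLinearMap.id ℝ ℂ +
        evalConj (pderiv 1 p) q.1 • (Complex.conjCLE : ℂ →L[ℝ] ℂ)).comp
          (ContinuousLinearMap.fst ℝ ℂ ℂ)) q := by
  rw [ofReal_modelFun_eq hQ]
  exact (((Complex.ofRealCLM.comp Complex.reCLM).comp
    (ContinuousLinearMap.snd ℝ ℂ ℂ)).hasFDerivAt (x := q)).add (hasFDerivAt_evalConj_fst p q)

theorem dz_modelFun :
    dz (fun q => (modelFun Q q : ℂ)) = fun q => evalConj (pderiv 0 p) q.1 := by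
  ext q
  simp only [dz, (hasFDerivAt_ofReal_modelFun hQ q).fderiv]
  simp
  linear_combination (-1/2 * evalConj (pderiv 0 p) q.1 + 1/2 * evalConj (pderiv 1 p) q.1) * Complex.I_sq

theorem dzbar_modelFun :
    dzbar (fun q => (modelFun Q q : ℂ)) = fun q => evalConj (pderiv 1 p) q.1 := by
  ext q
  simp only [dzbar, (hasFDerivAt_ofReal_modelFun hQ q).fderiv]
  simp
  linear_combination (1/2 * evalConj (pderiv 0 p) q.1 - 1/2 * evalConj (pderiv 1 p) q.1) * Complex.I_sq

theorem dw_modelFun : dw (fun q => (modelFun Q q : ℂ)) = fun _ => 1 / 2 := by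
  ext q
  simp [dw, (hasFDerivAt_ofReal_modelFun hQ q).fderiv]

theorem dwbar_modelFun : dwbar (fun q => (modelFun Q q : ℂ)) = fun _ => 1 / 2 := by
  ext q
  simp [dwbar, (hasFDerivAt_ofReal_modelFun hQ q).fderiv]

theorem tangentSlope_modelFun (q : ℂ × ℂ) :
    tangentSlope (modelFun Q) q = 2 * evalConj (pderiv 0 p) q.1 := by
  simp [tangentSlope, dw_modelFun hQ, dz_modelFun hQ]

theorem leviDeriv_modelFun (j k : ℕ) :
    leviDeriv (modelFun Q) j k = fun q => evalConj (mixedDeriv p j k) q.1 := by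
  -- `∂r/∂w̄` is constant and `∂r/∂z̄` depends on `z` alone, so only the `z z̄` entry of the Levi
  -- form survives.
  have h : (fun q => leviForm (modelFun Q) q (1, -tangentSlope (modelFun Q) q)
      (1, -tangentSlope (modelFun Q) q)) = fun q => evalConj (pderiv 0 (pderiv 1 p)) q.1 := by
    ext q
    simp only [leviForm, dzbar_modelFun hQ, dwbar_modelFun hQ, dz_evalConj, dw_evalConj]
    simp [dz, dw]
  rw [leviDeriv, h, iterate_opLbar_evalConj, iterate_opL_evalConj]
  rfl

/-- The numbers `C_l` of the model domain, in terms of the mixed derivatives of the polynomial. -/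
theorem leviMax_modelFun (l : ℕ) (q : ℂ × ℂ) :
    leviMax (modelFun Q) l q =
      (((Finset.HasAntidiagonal.antidiagonal l).filter fun jk => 0 < jk.1 ∧ 0 < jk.2).sup
        fun jk => ‖evalConj (mixedDeriv p jk.1 jk.2) q.1‖₊ : ℝ≥0) := by
  simp [leviMax, leviDeriv_modelFun hQ]

/-- Since `Q` is real, the differential equals its own conjugate; comparing the two on `1` and on
`I` separates the coefficients. -/
theorem evalConj_pderiv_one (z : ℂ) :
    evalConj (pderiv 1 p) z = conj (evalConj (pderiv 0 p) z) := by
  have h1 := hasFDerivAt_evalConj p z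
  have h2 : HasFDerivAt (fun z => conj (evalConj p z)) _ z :=
    (Complex.conjCLE : ℂ →L[ℝ] ℂ).hasFDerivAt.comp z h1
  have h3 : (fun z => conj (evalConj p z)) = evalConj p := by
    ext z
    rw [← hQ, Complex.conj_ofReal]
  rw [h3] at h2
  have h4 := h1.unique h2
  have h5 := DFunLike.congr_fun h4 1
  have h6 := DFunLike.congr_fun h4 Complex.I
  simp at h5 h6
  have h7 : (evalConj (pderiv 0 p) z - evalConj (pderiv 1 p) z -
    (conj (evalConj (pderiv 1 p) z) - conj (evalConj (pderiv 0 p) z))) = 0 := by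
    have : Complex.I * (evalConj (pderiv 0 p) z - evalConj (pderiv 1 p) z -
      (conj (evalConj (pderiv 1 p) z) - conj (evalConj (pderiv 0 p) z))) = 0 := by
      linear_combination h6
    simpa using this
  linear_combination (1/2) * h5 - (1/2) * h7

theorem hasFDerivAt_model (z : ℂ) :
    HasFDerivAt Q (Complex.reCLM.comp
      ((2 * evalConj (pderiv 0 p) z) • ContinuousLinearMap.id ℝ ℂ)) z := by
  have h1 := Complex.reCLM.hasFDerivAt.comp z (hasFDerivAt_evalConj p z)
  have h3 : (Complex.reCLM ∘ evalConj p) = Q := by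
    ext z
    simp [← hQ]
  rw [h3] at h1
  refine h1.congr_fderiv ?_
  ext x
  simp [evalConj_pderiv_one hQ]
  ring

theorem contDiff_model : ContDiff ℝ 1 Q := by
  have h3 : (Complex.reCLM ∘ evalConj p) = Q := by
    ext z
    simp [← hQ]
  rw [← h3]
  exact Complex.reCLM.contDiff.comp (contDiff_evalConj p)

end Model

end CatlinModel

/-! ### Geodesics and thin triangles in metric spaces -/

namespace CatlinModel

open Set Filter Topology

section Hyperbolicity

variable {X : Type*} [MetricSpace X]

/-- A pointwise ultralimit of the approximate geodesics exists by properness and is 1-Lipschitz. Its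
endpoints lie at full distance, so no subinterval can be shortened and the limit is isometric. -/
theorem isGeodesicSegment_exists_of_approx [ProperSpace X] {x y : X}
    (h : ∀ ε > 0, ∃ σ : ℝ → X, σ 0 = x ∧ σ (dist x y) = y ∧
      ∀ s ∈ Icc 0 (dist x y), ∀ t ∈ Icc 0 (dist x y), dist (σ s) (σ t) ≤ |t - s| + ε) :
    ∃ S, IsGeodesicSegment x y S := by
  have hpos : ∀ n : ℕ, (0 : ℝ) < 1 / (n + 1) := fun n => Nat.one_div_pos_of_nat
  choose σ h0 h1 hσ using fun n : ℕ => h (1 / ((n : ℝ) + 1)) (hpos n)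
  set U : Ultrafilter ℕ := hyperfilter ℕ with hU
  have hU' : (U : Filter ℕ) ≤ atTop := Nat.hyperfilter_le_atTop
  have hlim : ∀ s, ∃ z, s ∈ Icc 0 (dist x y) → Tendsto (fun n => σ n s) U (𝓝 z) := by
    intro s
    by_cases hs : s ∈ Icc 0 (dist x y)
    · obtain ⟨z, -, hz⟩ := (isCompact_closedBall x (dist x y + 1)).ultrafilter_le_nhds
        (U.map fun n => σ n s) (by
          simp only [Ultrafilter.coe_map, le_principal_iff, mem_map]
          refine univ_mem' fun n => ?_
          have h2 := hσ n s hs 0 ⟨le_rfl, dist_nonneg⟩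
          rw [h0, zero_sub, abs_neg, abs_of_nonneg hs.1] at h2
          have h3 : 1 / ((n : ℝ) + 1) ≤ 1 := by
            rw [div_le_one (by positivity)]; simp
          simp only [mem_preimage, Metric.mem_closedBall]
          linarith [hs.2])
      exact ⟨z, fun _ => hz⟩
    · exact ⟨x, fun h => absurd h hs⟩
  choose τ hτ using hlim
  have hmem0 : (0 : ℝ) ∈ Icc 0 (dist x y) := ⟨le_rfl, dist_nonneg⟩
  have hmem1 : dist x y ∈ Icc 0 (dist x y) := ⟨dist_nonneg, le_rfl⟩
  have hτ0 : τ 0 = x := by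
    have := hτ 0 hmem0
    simp only [h0] at this
    exact tendsto_nhds_unique this tendsto_const_nhds
  have hτ1 : τ (dist x y) = y := by
    have := hτ _ hmem1
    simp only [h1] at this
    exact tendsto_nhds_unique this tendsto_const_nhds
  have hle : ∀ s ∈ Icc 0 (dist x y), ∀ t ∈ Icc 0 (dist x y), dist (τ s) (τ t) ≤ |t - s| := by
    intro s hs t ht
    have h2 : Tendsto (fun n : ℕ => |t - s| + 1 / ((n : ℝ) + 1)) U (𝓝 (|t - s| + 0)) :=
      (tendsto_const_nhds.add tendsto_one_div_add_atTop_nhds_zero_nat).mono_left hU'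
    rw [add_zero] at h2
    exact le_of_tendsto_of_tendsto' ((hτ s hs).dist (hτ t ht)) h2 fun n => hσ n s hs t ht
  have hmono : ∀ s ∈ Icc 0 (dist x y), ∀ t ∈ Icc 0 (dist x y), s ≤ t →
      dist (τ s) (τ t) = |t - s| := by
    intro s hs t ht hst
    refine le_antisymm (hle s hs t ht) ?_
    have h2 := hle 0 hmem0 s hs
    have h3 := hle t ht _ hmem1
    have h4 := dist_triangle4 (τ 0) (τ s) (τ t) (τ (dist x y))
    rw [abs_of_nonneg (by linarith [hs.1])] at h2
    rw [abs_of_nonneg (by linarith [ht.2])] at h3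
    rw [hτ0, hτ1] at h4
    rw [hτ0] at h2
    rw [hτ1] at h3
    rw [abs_of_nonneg (sub_nonneg.2 hst)]
    linarith
  refine ⟨_, 0, dist x y, τ, dist_nonneg, fun s hs t ht => ?_, hτ0, hτ1, rfl⟩
  rcases le_total s t with hst | hst
  · exact hmono s hs t ht hst
  · rw [dist_comm, abs_sub_comm]; exact hmono t ht s hs hst

theorem IsGeodesicSegment.exists_dist_eq {x y : X} {S : Set X} (h : IsGeodesicSegment x y S) {s : ℝ}
    (h0 : 0 ≤ s) (h1 : s ≤ dist x y) : ∃ u ∈ S, dist x u = s ∧ dist u y = dist x y - s := by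
  obtain ⟨a, b, σ, hab, hσ, rfl, rfl, rfl⟩ := h
  have ha : a ∈ Icc a b := ⟨le_rfl, hab⟩
  have hb : b ∈ Icc a b := ⟨hab, le_rfl⟩
  have hd := hσ a ha b hb
  rw [abs_of_nonneg (sub_nonneg.2 hab)] at hd
  have hm : a + s ∈ Icc a b := ⟨by linarith, by linarith⟩
  refine ⟨σ (a + s), mem_image_of_mem _ hm, ?_, ?_⟩
  · rw [hσ a ha _ hm, add_sub_cancel_left, abs_of_nonneg h0]
  · rw [hσ _ hm b hb, abs_of_nonneg (by linarith), hd]; ring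

theorem IsGeodesicSegment.dist_add_dist {x y u : X} {S : Set X} (h : IsGeodesicSegment x y S)
    (hu : u ∈ S) : dist x u + dist u y = dist x y := by
  obtain ⟨a, b, σ, hab, hσ, rfl, rfl, rfl⟩ := h
  obtain ⟨t, ht, rfl⟩ := hu
  have ha : a ∈ Icc a b := ⟨le_rfl, hab⟩
  have hb : b ∈ Icc a b := ⟨hab, le_rfl⟩
  rw [hσ a ha t ht, hσ t ht b hb, hσ a ha b hb, abs_of_nonneg (sub_nonneg.2 hab),
    abs_of_nonneg (sub_nonneg.2 ht.1), abs_of_nonneg (sub_nonneg.2 ht.2)]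
  ring

theorem IsGeodesicSegment.symm {x y : X} {S : Set X} (h : IsGeodesicSegment x y S) :
    IsGeodesicSegment y x S := by
  obtain ⟨a, b, σ, hab, hσ, rfl, rfl, rfl⟩ := h
  have himg : ∀ t ∈ Icc a b, a + b - t ∈ Icc a b := fun t ht =>
    ⟨by linarith [ht.2], by linarith [ht.1]⟩
  refine ⟨a, b, fun t => σ (a + b - t), hab, fun s hs t ht => ?_, by simp, by simp, ?_⟩
  · rw [hσ _ (himg s hs) _ (himg t ht), abs_sub_comm]; congr 1; ring
  · ext u; constructor
    · rintro ⟨t, ht, rfl⟩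
      exact ⟨a + b - t, himg t ht, by simp⟩
    · rintro ⟨t, ht, rfl⟩
      exact ⟨a + b - t, himg t ht, rfl⟩

/-- The four point condition for Gromov hyperbolicity. -/
def FourPoint (X : Type*) [MetricSpace X] (δ : ℝ) : Prop :=
  ∀ p q r s : X, dist p q + dist r s ≤ max (dist p r + dist q s) (dist p s + dist q r) + δ

/-- The hypothesis says that `u` is no farther from `x` than the Gromov product of `y` and `z` at
`x`. The companion `v` is the point of the other side at the same distance from `x`. One use of the
four point condition bounds `dist u z`, a second one bounds `dist u v`. -/
theorem thin_corner {δ : ℝ} (h4 : FourPoint X δ) {x y z u : X} {S : Set X}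
    (hS : IsGeodesicSegment x z S) (hu : dist x u + dist u y = dist x y)
    (hle : 2 * dist x u ≤ dist x y + dist x z - dist y z) : ∃ v ∈ S, dist u v ≤ 2 * δ := by
  obtain ⟨v, hv, hxv, hvz⟩ := hS.exists_dist_eq (s := dist x u) dist_nonneg
    (by linarith [dist_triangle x z y, dist_comm y z])
  refine ⟨v, hv, ?_⟩
  have h1 := h4 x y u z
  have h2 := h4 x z u v
  have c1 := dist_comm y u
  have c2 := dist_comm u v
  have c3 := dist_comm z v
  have c4 := dist_comm z u
  -- Four equal points give `0 ≤ δ`.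
  have h5 := h4 x x x x
  simp at h5
  rcases max_choice (dist x u + dist y z) (dist x z + dist y u) with h | h <;> rw [h] at h1 <;>
  rcases max_choice (dist x u + dist z v) (dist x v + dist z u) with h' | h' <;> rw [h'] at h2 <;>
  linarith

/-- The Gromov products at `x` and at `y` add up to `dist x y`, so `u` lies in the corner of `x` or
in that of `y`. -/
theorem thin_of_fourPoint {δ : ℝ} (h4 : FourPoint X δ) {x y z u : X} {S₁ S₂ S₃ : Set X}
    (h₁ : IsGeodesicSegment x y S₁) (h₂ : IsGeodesicSegment y z S₂)
    (h₃ : IsGeodesicSegment z x S₃) (hu : u ∈ S₁) : ∃ v ∈ S₂ ∪ S₃, dist u v ≤ 2 * δ := by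
  have hd := h₁.dist_add_dist hu
  rcases le_total (2 * dist x u) (dist x y + dist x z - dist y z) with h | h
  · obtain ⟨v, hv, hv'⟩ := thin_corner h4 h₃.symm hd h
    exact ⟨v, Or.inr hv, hv'⟩
  · obtain ⟨v, hv, hv'⟩ := thin_corner h4 (x := y) (y := x) (u := u) h₂
      (by rw [dist_comm y u, dist_comm u x, dist_comm y x]; linarith)
      (by rw [dist_comm y u, dist_comm y x]; linarith)
    exact ⟨v, Or.inl hv, hv'⟩

/-- A family of pseudodistances `E τ`, thought of as distances on the level sets `{height = τ}`,
contracting exponentially in `τ` and comparable with the distance of `X`. -/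
structure LevelFamily (X : Type*) [MetricSpace X] (height : X → ℝ) (E : ℝ → X → X → ℝ) (a : ℝ) :
    Prop where
  pos : 0 < a
  self : ∀ τ x, E τ x x = 0
  symm : ∀ τ x y, E τ x y = E τ y x
  triangle : ∀ τ x y z, E τ x z ≤ E τ x y + E τ y z
  height_le : ∀ x y, height y ≤ height x + dist x y
  dist_le : ∀ τ x y, height x ≤ τ → height y ≤ τ →
    dist x y ≤ (τ - height x) + (τ - height y) + E τ x y
  le_of_dist_le : ∀ τ x y, dist x y ≤ 1 → height x + 2 ≤ τ →
    E τ x y ≤ 2 * Real.exp (a * (height x + 2 - τ))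

/-! ### Exponentially contracting level sets imply the four point condition -/

variable {height : X → ℝ} {E : ℝ → X → X → ℝ} {a : ℝ}

/-- Height grows by at most one per unit step, so the `n` pieces contribute a geometric series
dominated by its last term. The constant `C` is the solution of `C * exp a = C + 2 * exp (2 * a)`,
which closes the induction. -/
theorem LevelFamily.chain (hE : LevelFamily X height E a)
    (hgeo : ∀ x y : X, ∃ S, IsGeodesicSegment x y S) (n : ℕ) :
    ∀ (τ : ℝ) (x y : X), dist x y ≤ n → height x + n + 2 ≤ τ →
      E τ x y ≤ 2 * Real.exp (2 * a) / (Real.exp a - 1) * Real.exp (a * (height x + n - τ)) := by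
  have ha : 0 < Real.exp a - 1 := by linarith [Real.add_one_lt_exp hE.pos.ne', hE.pos]
  induction n with
  | zero =>
    intro τ x y hxy hτ
    obtain rfl : x = y := dist_le_zero.1 (by simpa using hxy)
    rw [hE.self]
    positivity
  | succ n ih =>
    intro τ x y hxy hτ
    push_cast at hxy hτ ⊢
    obtain ⟨S, hS⟩ := hgeo x y
    obtain ⟨u, -, hu1, hu2⟩ := hS.exists_dist_eq (s := min (n : ℝ) (dist x y))
      (le_min (by positivity) dist_nonneg) (min_le_right _ _)
    have h1 := ih τ x u (hu1.trans_le (min_le_left _ _)) (by linarith)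
    have h2 := hE.height_le x u
    have h3 : height u ≤ height x + n := by linarith [min_le_left (n : ℝ) (dist x y)]
    have h4 := hE.le_of_dist_le τ u y (by
      rw [hu2]; rcases min_choice (n : ℝ) (dist x y) with h | h <;> rw [h] <;> linarith)
      (by linarith)
    have h5 : Real.exp (a * (height u + 2 - τ)) ≤
        Real.exp (2 * a) * Real.exp (a * (height x + n - τ)) := by
      rw [← Real.exp_add]
      exact Real.exp_le_exp.2 (by nlinarith [hE.pos])
    have h6 : Real.exp (a * (height x + (n + 1) - τ)) =
        Real.exp a * Real.exp (a * (height x + n - τ)) := by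
      rw [← Real.exp_add]; ring_nf
    refine (hE.triangle τ x u y).trans ((add_le_add h1 h4).trans ?_)
    rw [h6]
    have h7 : 2 * Real.exp (2 * a) / (Real.exp a - 1) * (Real.exp a *
        Real.exp (a * (height x + n - τ))) =
        2 * Real.exp (2 * a) / (Real.exp a - 1) * Real.exp (a * (height x + n - τ)) +
        2 * (Real.exp (2 * a) * Real.exp (a * (height x + n - τ))) := by
      field_simp; ring
    linarith

theorem LevelFamily.exists_le_one (hE : LevelFamily X height E a)
    (hgeo : ∀ x y : X, ∃ S, IsGeodesicSegment x y S) :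
    ∃ K : ℝ, 3 ≤ K ∧ ∀ τ x y, (dist x y + height x + height y) / 2 + K ≤ τ → E τ x y ≤ 1 := by
  have ha : 0 < Real.exp a - 1 := by linarith [Real.add_one_lt_exp hE.pos.ne', hE.pos]
  set C := 2 * Real.exp (2 * a) / (Real.exp a - 1) with hC
  have hCpos : 0 < C := by positivity
  obtain ⟨K₀, hK₀⟩ : ∃ K₀ : ℝ, C * Real.exp (a * (1 - K₀)) ≤ 1 / 2 := by
    refine ⟨1 - Real.log (1 / (2 * C)) / a, ?_⟩
    have : a * (1 - (1 - Real.log (1 / (2 * C)) / a)) = Real.log (1 / (2 * C)) := by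
      field_simp [hE.pos.ne']; ring
    rw [this, Real.exp_log (by positivity)]
    apply le_of_eq; field_simp
  -- The `3` pays for the `+ 2` required by `LevelFamily.chain` and for rounding a length up to an
  -- integer.
  refine ⟨max 3 K₀, le_max_left _ _, fun τ x y hτ => ?_⟩
  have h3 := le_max_left 3 K₀
  have hK := le_max_right 3 K₀
  set L := (dist x y + height x + height y) / 2 with hL
  have e1 := hE.height_le x y
  have e2 := hE.height_le y x
  rw [dist_comm y x] at e2
  obtain ⟨S, hS⟩ := hgeo x y
  -- The apex `u`: seen from either endpoint, height plus distance to `u` equals `L`, so both halves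
  -- of the geodesic reach level `L` at most.
  obtain ⟨u, -, hu1, hu2⟩ := hS.exists_dist_eq (s := L - height x) (by linarith) (by linarith)
  have key : ∀ z, dist z u = L - height z → E τ z u ≤ 1 / 2 := by
    intro z hz
    have hz0 : 0 ≤ L - height z := hz ▸ dist_nonneg
    have f1 := Nat.le_ceil (L - height z)
    have f2 := Nat.ceil_lt_add_one hz0
    refine (hE.chain hgeo ⌈L - height z⌉₊ τ z u (hz.trans_le f1) (by linarith)).trans
      (le_trans ?_ hK₀)
    rw [← hC]
    have : a * (height z + ⌈L - height z⌉₊ - τ) ≤ a * (1 - K₀) :=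
      mul_le_mul_of_nonneg_left (by linarith) hE.pos.le
    gcongr
  have k1 := key x hu1
  have k2 := key y (by rw [dist_comm, hu2]; linarith)
  have := hE.triangle τ x u y
  rw [hE.symm τ u y] at this
  linarith

theorem LevelFamily.fourPoint (hE : LevelFamily X height E a)
    (hgeo : ∀ x y : X, ∃ S, IsGeodesicSegment x y S) : ∃ δ, 0 ≤ δ ∧ FourPoint X δ := by
  obtain ⟨K, hK3, hK⟩ := hE.exists_le_one hgeo
  set L : X → X → ℝ := fun x y => (dist x y + height x + height y) / 2 with hL
  have hLsymm : ∀ x y, L x y = L y x := fun x y => by simp only [hL, dist_comm]; ring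
  -- At level `τ` both `E τ x y` and `E τ y z` are at most `1`, so `x` and `z` are joined by going
  -- up, across at cost at most `2`, and down.
  have hmax : ∀ x y z, L x z ≤ max (L x y) (L y z) + (K + 1) := by
    intro x y z
    have a1 := le_max_left (L x y) (L y z)
    have a2 := le_max_right (L x y) (L y z)
    set τ := max (L x y) (L y z) + K with hτ
    have h1 := hK τ x y (show L x y + K ≤ τ by linarith)
    have h2 := hK τ y z (show L y z + K ≤ τ by linarith)
    have e1 := hE.height_le y x
    have e2 := hE.height_le y z
    rw [dist_comm] at e1
    have h3 := hE.dist_le τ x z (by simp only [hL] at a1; linarith) (by simp only [hL] at a2; linarith)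
    have h4 := hE.triangle τ x y z
    have : L x z = (dist x z + height x + height z) / 2 := rfl
    linarith
  refine ⟨4 * (K + 1), by linarith, fun p q r s => ?_⟩
  have hd : ∀ x y, dist x y = 2 * L x y - height x - height y := fun x y => by simp only [hL]; ring
  -- The four point inequality of an ultrametric, with two uses of the error `K + 1`. The heights
  -- cancel when `L` is converted back to distances.
  have key : L p q + L r s ≤ max (L p r + L q s) (L p s + L q r) + 2 * (K + 1) := by
    have h1 := hmax p r q
    have h2 := hmax p s q
    have h3 := hmax r p s
    have h4 := hmax r q s
    rw [hLsymm r q] at h1 h4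
    rw [hLsymm s q] at h2
    rw [hLsymm r p] at h3
    have m1 := le_max_left (L p r + L q s) (L p s + L q r)
    have m2 := le_max_right (L p r + L q s) (L p s + L q r)
    rcases max_cases (L p r) (L q r) with ⟨h, h'⟩ | ⟨h, h'⟩ <;> rw [h] at h1 <;>
    rcases max_cases (L p s) (L q s) with ⟨g, g'⟩ | ⟨g, g'⟩ <;> rw [g] at h2 <;>
    rcases max_cases (L p r) (L p s) with ⟨i, i'⟩ | ⟨i, i'⟩ <;> rw [i] at h3 <;>
    rcases max_cases (L q r) (L q s) with ⟨j, j'⟩ | ⟨j, j'⟩ <;> rw [j] at h4 <;>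
    linarith
  rw [hd p q, hd r s, hd p r, hd q s, hd p s, hd q r]
  rcases max_choice (L p r + L q s) (L p s + L q r) with h | h <;> rw [h] at key
  · refine le_trans ?_ (add_le_add_left (le_max_left _ _) _); linarith
  · refine le_trans ?_ (add_le_add_left (le_max_right _ _) _); linarith

theorem isGromovHyperbolic_of_levelFamily [ProperSpace X] (hE : LevelFamily X height E a)
    (hgeo : ∀ x y : X, ∃ S, IsGeodesicSegment x y S) : IsGromovHyperbolic X := by
  obtain ⟨δ, hδ, h4⟩ := hE.fourPoint hgeo
  exact ⟨inferInstance, hgeo, 2 * δ, by positivity, fun x y z S₁ S₂ S₃ h₁ h₂ h₃ u hu =>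
    thin_of_fourPoint h4 h₁ h₂ h₃ hu⟩

end Hyperbolicity

end CatlinModel

/-! ### Lower bound and scaling of the horizontal coefficient -/

namespace CatlinModel

open MvPolynomial

theorem coeff_iterate_pderiv (i : Fin 2) (n : ℕ) (q : MvPolynomial (Fin 2) ℂ) (u : Fin 2 →₀ ℕ) :
    ∃ N : ℕ, N ≠ 0 ∧ coeff u ((pderiv i)^[n] q) = N * coeff (u + Finsupp.single i n) q := by
  induction n generalizing q with
  | zero => exact ⟨1, one_ne_zero, by simp⟩
  | succ n ih =>
    obtain ⟨N, hN, h⟩ := ih (pderiv i q)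
    refine ⟨N * (u i + n + 1), by positivity, ?_⟩
    rw [Function.iterate_succ_apply, h, coeff_pderiv, add_assoc, ← Finsupp.single_add]
    simp only [Finsupp.add_apply, Finsupp.single_eq_same]
    push_cast
    ring

theorem coeff_mixedDeriv (q : MvPolynomial (Fin 2) ℂ) {j k : ℕ} (hj : 0 < j) (hk : 0 < k)
    (u : Fin 2 →₀ ℕ) : ∃ N : ℕ, N ≠ 0 ∧
      coeff u (mixedDeriv q j k) =
        N * coeff (u + (Finsupp.single 0 j + Finsupp.single 1 k)) q := by
  obtain ⟨N₁, h₁, e₁⟩ := coeff_iterate_pderiv 0 (j - 1)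
    ((pderiv 1)^[k - 1] (pderiv 0 (pderiv 1 q))) u
  obtain ⟨N₂, h₂, e₂⟩ := coeff_iterate_pderiv 1 (k - 1) (pderiv 0 (pderiv 1 q))
    (u + Finsupp.single 0 (j - 1))
  obtain ⟨N₃, h₃, e₃⟩ := coeff_iterate_pderiv 0 1 (pderiv 1 q)
    (u + Finsupp.single 0 (j - 1) + Finsupp.single 1 (k - 1))
  obtain ⟨N₄, h₄, e₄⟩ := coeff_iterate_pderiv 1 1 q
    (u + Finsupp.single 0 (j - 1) + Finsupp.single 1 (k - 1) + Finsupp.single 0 1)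
  refine ⟨N₁ * N₂ * N₃ * N₄, by positivity, ?_⟩
  have hs : u + Finsupp.single 0 (j - 1) + Finsupp.single 1 (k - 1) + Finsupp.single 0 1 +
      Finsupp.single 1 1 = u + (Finsupp.single 0 j + Finsupp.single 1 k) := by
    obtain ⟨j, rfl⟩ := Nat.exists_eq_add_of_lt hj
    obtain ⟨k, rfl⟩ := Nat.exists_eq_add_of_lt hk
    simp only [zero_add, Nat.add_sub_cancel, Finsupp.single_add]
    abel
  simp only [Function.iterate_one] at e₃ e₄
  rw [mixedDeriv, e₁, e₂, e₃, e₄, hs]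
  push_cast
  ring

/-- The maximum at `z` of the absolute values of the mixed derivatives of order `l`. -/
noncomputable def mixedMax (p : MvPolynomial (Fin 2) ℂ) (l : ℕ) (z : ℂ) : ℝ :=
  (((Finset.HasAntidiagonal.antidiagonal l).filter fun jk => 0 < jk.1 ∧ 0 < jk.2).sup
        fun jk => ‖evalConj (mixedDeriv p jk.1 jk.2) z‖₊ : ℝ≥0)

theorem mixedMax_nonneg (p : MvPolynomial (Fin 2) ℂ) (l : ℕ) (z : ℂ) : 0 ≤ mixedMax p l z :=
  NNReal.coe_nonneg _

theorem continuous_mixedMax (p : MvPolynomial (Fin 2) ℂ) (l : ℕ) : Continuous (mixedMax p l) :=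
  NNReal.continuous_coe.comp (Continuous.finset_sup_apply fun jk _ =>
    (contDiff_evalConj (mixedDeriv p jk.1 jk.2)).continuous.nnnorm)

/-- Take a monomial of top degree. Both its exponents are positive, and differentiating by exactly
these exponents leaves a constant: any other surviving coefficient would come from a monomial of
larger degree. -/
theorem exists_le_mixedMax {p : MvPolynomial (Fin 2) ℂ} (hp : p ≠ 0)
    (hh : ∀ s : Fin 2 →₀ ℕ, s 0 = 0 ∨ s 1 = 0 → p.coeff s = 0) :
    2 ≤ p.totalDegree ∧ ∃ c > 0, ∀ z, c ≤ mixedMax p p.totalDegree z := by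
  obtain ⟨s, hs, hsd⟩ := p.support.exists_mem_eq_sup (support_nonempty.2 hp)
    fun s => s.sum fun _ e => e
  replace hsd : p.totalDegree = s 0 + s 1 := by
    rw [totalDegree, hsd, Finsupp.sum_fintype _ _ (by simp)]; simp
  have hcs : p.coeff s ≠ 0 := mem_support_iff.1 hs
  have h0 : 0 < s 0 := Nat.pos_of_ne_zero fun h => hcs (hh s (Or.inl h))
  have h1 : 0 < s 1 := Nat.pos_of_ne_zero fun h => hcs (hh s (Or.inr h))
  have hss : Finsupp.single 0 (s 0) + Finsupp.single 1 (s 1) = s := by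
    ext i; fin_cases i <;> simp
  have hC : mixedDeriv p (s 0) (s 1) = C (coeff 0 (mixedDeriv p (s 0) (s 1))) := by
    ext u
    rw [coeff_C]
    split_ifs with hu
    · rw [hu]
    · obtain ⟨N, -, hN⟩ := coeff_mixedDeriv p h0 h1 u
      rw [hN, hss]
      refine mul_eq_zero_of_right _ (by_contra fun hne => hu ?_)
      have h2 := le_totalDegree (mem_support_iff.2 hne)
      rw [Finsupp.sum_fintype _ _ (by simp), hsd] at h2
      simp at h2
      ext i; fin_cases i <;> simp <;> omega
  obtain ⟨N, hN0, hN⟩ := coeff_mixedDeriv p h0 h1 0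
  rw [hss, zero_add] at hN
  refine ⟨by omega, ‖(N : ℂ) * coeff s p‖,
    norm_pos_iff.2 (mul_ne_zero (Nat.cast_ne_zero.2 hN0) hcs), fun z => ?_⟩
  have h3 : evalConj (mixedDeriv p (s 0) (s 1)) z = N * coeff s p := by
    rw [hC, evalConj, eval_C, hN]
  rw [← h3, mixedMax, ← coe_nnnorm, NNReal.coe_le_coe]
  exact Finset.le_sup (f := fun jk : ℕ × ℕ => ‖evalConj (mixedDeriv p jk.1 jk.2) z‖₊)
    (b := (s 0, s 1)) (by simp [hsd, h0, h1])

/-- The coefficient of `|a|` in the Catlin metric at a point over `z` of height `h`. -/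
noncomputable def horizontalCoeff (p : MvPolynomial (Fin 2) ℂ) (z : ℂ) (h : ℝ) : ℝ :=
  ∑ l ∈ Finset.Icc 2 p.totalDegree, (mixedMax p l z / h) ^ (1 / (l : ℝ))

section HorizontalCoeff

variable (p : MvPolynomial (Fin 2) ℂ)

theorem horizontalCoeff_nonneg (z : ℂ) {h : ℝ} (hh : 0 ≤ h) : 0 ≤ horizontalCoeff p z h :=
  Finset.sum_nonneg fun l _ => Real.rpow_nonneg (div_nonneg (mixedMax_nonneg p l z) hh) _

/-- The order `l` term scales by `(h/T)^(1/l)`; as `h/T ≤ 1`, the largest of these factors belongs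
to the top order. -/
theorem horizontalCoeff_le (z : ℂ) {h T : ℝ} (hh : 0 < h) (hT : h ≤ T) :
    horizontalCoeff p z T ≤ (h / T) ^ (1 / (p.totalDegree : ℝ)) * horizontalCoeff p z h := by
  have hTp := hh.trans_le hT
  rw [horizontalCoeff, horizontalCoeff, Finset.mul_sum]
  refine Finset.sum_le_sum fun l hl => ?_
  rw [Finset.mem_Icc] at hl
  have e : mixedMax p l z / T = h / T * (mixedMax p l z / h) := by field_simp
  rw [e, Real.mul_rpow (by positivity) (div_nonneg (mixedMax_nonneg p l z) hh.le)]
  refine mul_le_mul_of_nonneg_right ?_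
    (Real.rpow_nonneg (div_nonneg (mixedMax_nonneg p l z) hh.le) _)
  refine Real.rpow_le_rpow_of_exponent_ge (by positivity) ((div_le_one hTp).2 hT) ?_
  exact one_div_le_one_div_of_le (by norm_cast; omega) (by exact_mod_cast hl.2)

theorem le_horizontalCoeff (h2 : 2 ≤ p.totalDegree) {c : ℝ} (hc : 0 < c) {z : ℂ}
    (hz : c ≤ mixedMax p p.totalDegree z) {h : ℝ} (hh : 0 < h) :
    (c / h) ^ (1 / (p.totalDegree : ℝ)) ≤ horizontalCoeff p z h := by
  refine le_trans (Real.rpow_le_rpow (by positivity) (div_le_div_of_nonneg_right hz hh.le)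
    (by positivity)) ?_
  exact Finset.single_le_sum (f := fun l : ℕ => (mixedMax p l z / h) ^ (1 / (l : ℝ)))
    (fun l _ => Real.rpow_nonneg (div_nonneg (mixedMax_nonneg p l z) hh.le) _)
    (Finset.mem_Icc.2 ⟨h2, le_rfl⟩)

theorem continuousAt_horizontalCoeff {α : Type*} [TopologicalSpace α] {f : α → ℂ} {g : α → ℝ}
    {x : α} (hf : ContinuousAt f x) (hg : ContinuousAt g x) (h0 : g x ≠ 0) :
    ContinuousAt (fun y => horizontalCoeff p (f y) (g y)) x := by
  refine tendsto_finsetSum _ fun l hl => ?_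
  rw [Finset.mem_Icc] at hl
  exact (((continuous_mixedMax p l).continuousAt.comp hf).div hg h0).rpow_const
    (Or.inr (by positivity))

end HorizontalCoeff

theorem catlinMetric_modelFun {Q : ℂ → ℝ} {p : MvPolynomial (Fin 2) ℂ}
    (hQ : ∀ z, (Q z : ℂ) = evalConj p z) (q v : ℂ × ℂ) :
    catlinMetric (modelFun Q) p.totalDegree q v =
      ‖v.2 + 2 * evalConj (pderiv 0 p) q.1 * v.1‖ / |modelFun Q q| +
        ‖v.1‖ * horizontalCoeff p q.1 |modelFun Q q| := by
  simp only [catlinMetric, tangentSlope_modelFun hQ, leviMax_modelFun hQ]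
  rfl

end CatlinModel

/-! ### Heights, level metrics and their comparison with the Catlin distance -/

namespace CatlinModel

open MeasureTheory Set Filter Topology

section Comparison

variable {F F' : ℂ × ℂ → ℂ × ℂ → ℝ} {γ γ' : ℝ → ℂ × ℂ} {a b C : ℝ}

theorem pathLen_le_mul (hC : 0 ≤ C)
    (h : ∀ᵐ t, t ∈ Icc a b → F (γ t) (deriv γ t) ≤ C * F' (γ' t) (deriv γ' t)) :
    pathLen F γ a b ≤ ENNReal.ofReal C * pathLen F' γ' a b := by
  unfold pathLen
  rw [← lintegral_const_mul' _ _ ENNReal.ofReal_ne_top]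
  refine lintegral_mono_ae ((ae_restrict_iff' measurableSet_Icc).2 ?_)
  filter_upwards [h] with t ht hmem
  rw [← ENNReal.ofReal_mul hC]
  exact ENNReal.ofReal_le_ofReal (ht hmem)

theorem PC1.enorm_sub_le_mul_pathLen {G : Type*} [NormedAddCommGroup G] [NormedSpace ℝ G]
    {σ : ℝ → G} (hσ : PC1 σ a b) (hC : 0 ≤ C)
    (h : ∀ᵐ t, t ∈ Icc a b → ‖deriv σ t‖ ≤ C * F (γ t) (deriv γ t)) :
    ‖σ b - σ a‖ₑ ≤ ENNReal.ofReal C * pathLen F γ a b := by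
  refine hσ.enorm_sub_le.trans ?_
  unfold pathLen
  rw [← lintegral_const_mul' _ _ ENNReal.ofReal_ne_top]
  refine lintegral_mono_ae ((ae_restrict_iff' measurableSet_Icc).2 ?_)
  filter_upwards [h] with t ht hmem
  rw [← ENNReal.ofReal_mul hC, ← ofReal_norm]
  exact ENNReal.ofReal_le_ofReal (ht hmem)

end Comparison

/-- The component `b` of `v = a L + b ∂/∂w`. -/
noncomputable def normalPart (p : MvPolynomial (Fin 2) ℂ) (q v : ℂ × ℂ) : ℂ :=
  v.2 + 2 * evalConj (MvPolynomial.pderiv 0 p) q.1 * v.1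

theorem normalPart_smul (p : MvPolynomial (Fin 2) ℂ) (q v : ℂ × ℂ) (s : ℝ) :
    normalPart p q (s • v) = s * normalPart p q v := by
  simp [normalPart]; ring

/-- The Finsler pseudometric induced by the Catlin metric on the level set at height `T`,
in the coordinates `z` and `Im w`. -/
noncomputable def levelMetric (p : MvPolynomial (Fin 2) ℂ) (T : ℝ) (q v : ℂ × ℂ) : ℝ :=
  |(normalPart p q v).im| / T + ‖v.1‖ * horizontalCoeff p q.1 T

theorem levelMetric_smul (p : MvPolynomial (Fin 2) ℂ) (T : ℝ) (q v : ℂ × ℂ) (s : ℝ) :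
    levelMetric p T q (s • v) = |s| * levelMetric p T q v := by
  simp [levelMetric, normalPart_smul, abs_mul]; ring

/-- The pseudodistance of the level set at height `T`. -/
noncomputable def levelEDist (p : MvPolynomial (Fin 2) ℂ) (T : ℝ) (q q' : ℂ × ℂ) : ℝ≥0∞ :=
  finslerEDist univ (levelMetric p T) q q'

theorem levelEDist_ne_top (p : MvPolynomial (Fin 2) ℂ) {T : ℝ} (hT : 0 < T) (q q' : ℂ × ℂ) :
    levelEDist p T q q' ≠ ∞ := by
  set γ : ℝ → ℂ × ℂ := fun t => q + t • (q' - q) with hγ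
  have hd : ∀ t, deriv γ t = q' - q := fun t => by
    have h : HasDerivAt γ ((1 : ℝ) • (q' - q)) t :=
      ((hasDerivAt_id t).smul_const (q' - q)).const_add q
    rw [h.deriv, one_smul]
  have hγc : ContDiff ℝ 1 γ := by fun_prop
  have h1 := finslerEDist_le (Ω := univ) (levelMetric_smul p T)
    (PC1.of_contDiffOn zero_le_one hγc.contDiffOn) (fun _ _ => mem_univ _)
  have e0 : γ 0 = q := by simp [hγ]
  have e1 : γ 1 = q' := by simp [hγ]
  rw [e0, e1] at h1
  refine ne_top_of_le_ne_top ?_ h1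
  have hcont : Continuous fun t => levelMetric p T (γ t) (q' - q) := by
    refine continuous_iff_continuousAt.2 fun t => ?_
    have hγ1 : Continuous fun t => (γ t).1 := continuous_fst.comp hγc.continuous
    have h2 : Continuous fun t => normalPart p (γ t) (q' - q) := by
      have := (contDiff_evalConj (MvPolynomial.pderiv 0 p)).continuous.comp hγ1
      unfold normalPart
      exact continuous_const.add ((continuous_const.mul this).mul continuous_const)
    exact ((Complex.continuous_im.comp h2).abs.div_const T).continuousAt.add
      (continuousAt_const.mul (continuousAt_horizontalCoeff p hγ1.continuousAt
        continuousAt_const hT.ne'))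
  unfold pathLen
  simp only [hd]
  exact (hcont.integrableOn_Icc.lintegral_lt_top).ne

section Model

variable {Q : ℂ → ℝ} {p : MvPolynomial (Fin 2) ℂ} (hQ : ∀ z, (Q z : ℂ) = evalConj p z)

/-- The distance from the boundary in the direction of `Re w`. -/
def height (Q : ℂ → ℝ) (q : ℂ × ℂ) : ℝ := -modelFun Q q

theorem height_pos {q : ℂ × ℂ} (hq : q ∈ modelDomain Q) : 0 < height Q q := neg_pos.2 hq

include hQ

theorem catlinMetric_eq {q : ℂ × ℂ} (hq : q ∈ modelDomain Q) (v : ℂ × ℂ) :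
    catlinMetric (modelFun Q) p.totalDegree q v =
      ‖normalPart p q v‖ / height Q q + ‖v.1‖ * horizontalCoeff p q.1 (height Q q) := by
  rw [catlinMetric_modelFun hQ, abs_of_neg (show modelFun Q q < 0 from hq)]
  rfl

theorem catlinMetric_smul (q v : ℂ × ℂ) (s : ℝ) :
    catlinMetric (modelFun Q) p.totalDegree q (s • v) =
      |s| * catlinMetric (modelFun Q) p.totalDegree q v := by
  have h := normalPart_smul p q v s
  unfold normalPart at h
  rw [catlinMetric_modelFun hQ, catlinMetric_modelFun hQ, h]
  simp; ring

theorem norm_normalPart_le {q : ℂ × ℂ} (hq : q ∈ modelDomain Q) (v : ℂ × ℂ) :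
    ‖normalPart p q v‖ ≤ height Q q * catlinMetric (modelFun Q) p.totalDegree q v := by
  have hh := height_pos hq
  rw [catlinMetric_eq hQ hq, mul_add, mul_div_cancel₀ _ hh.ne']
  have := horizontalCoeff_nonneg p q.1 hh.le
  exact le_add_of_nonneg_right (by positivity)

theorem catlinMetric_nonneg {q : ℂ × ℂ} (hq : q ∈ modelDomain Q) (v : ℂ × ℂ) :
    0 ≤ catlinMetric (modelFun Q) p.totalDegree q v := by
  have hh := height_pos hq
  have := horizontalCoeff_nonneg p q.1 hh.le
  rw [catlinMetric_eq hQ hq]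
  positivity

theorem levelMetric_le (h2 : 2 ≤ p.totalDegree) {q : ℂ × ℂ} (hq : q ∈ modelDomain Q) {T : ℝ}
    (hT : height Q q ≤ T) (v : ℂ × ℂ) :
    levelMetric p T q v ≤ (height Q q / T) ^ (1 / (p.totalDegree : ℝ)) *
      catlinMetric (modelFun Q) p.totalDegree q v := by
  have hh := height_pos hq
  have hTp := hh.trans_le hT
  rw [catlinMetric_eq hQ hq, levelMetric, mul_add]
  refine add_le_add ?_ ?_
  · have h1 : height Q q / T ≤ (height Q q / T) ^ (1 / (p.totalDegree : ℝ)) := by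
      have := Real.rpow_le_rpow_of_exponent_ge (x := height Q q / T) (by positivity)
        ((div_le_one hTp).2 hT) (y := 1) (z := 1 / (p.totalDegree : ℝ)) (by
          rw [div_le_one (by norm_cast; omega)]; norm_cast; omega)
      rwa [Real.rpow_one] at this
    calc |(normalPart p q v).im| / T ≤ ‖normalPart p q v‖ / T :=
          div_le_div_of_nonneg_right (Complex.abs_im_le_norm _) hTp.le
      _ = height Q q / T * (‖normalPart p q v‖ / height Q q) := by field_simp
      _ ≤ _ := by gcongr
  · rw [mul_left_comm]
    exact mul_le_mul_of_nonneg_left (horizontalCoeff_le p q.1 hh hT) (norm_nonneg _)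

theorem hasFDerivAt_modelFun (q : ℂ × ℂ) :
    HasFDerivAt (modelFun Q) (Complex.reCLM.comp (ContinuousLinearMap.snd ℝ ℂ ℂ) +
      (Complex.reCLM.comp ((2 * evalConj (MvPolynomial.pderiv 0 p) q.1) •
        ContinuousLinearMap.id ℝ ℂ)).comp (ContinuousLinearMap.fst ℝ ℂ ℂ)) q :=
  ((Complex.reCLM.comp (ContinuousLinearMap.snd ℝ ℂ ℂ)).hasFDerivAt (x := q)).add
    ((hasFDerivAt_model hQ q.1).comp q hasFDerivAt_fst)

theorem contDiff_modelFun : ContDiff ℝ 1 (modelFun Q) :=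
  (Complex.reCLM.contDiff.comp contDiff_snd).add ((contDiff_model hQ).comp contDiff_fst)

theorem isOpen_modelDomain : IsOpen (modelDomain Q) :=
  isOpen_lt (contDiff_modelFun hQ).continuous continuous_const

theorem hasDerivAt_height {γ : ℝ → ℂ × ℂ} {t : ℝ} (h : DifferentiableAt ℝ γ t) :
    HasDerivAt (fun t => height Q (γ t)) (-(normalPart p (γ t) (deriv γ t)).re) t := by
  have := ((hasFDerivAt_modelFun hQ (γ t)).comp_hasDerivAt t h.hasDerivAt).neg
  refine this.congr_deriv ?_
  simp [normalPart]

/-- Along a curve `h' = -Re b`, so `|(log h)'| ≤ |b| / h`, which is the normal term of the metric.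
-/
theorem abs_log_height_sub_le {γ : ℝ → ℂ × ℂ} {a b : ℝ} (h : PC1 γ a b)
    (hΩ : ∀ t ∈ Icc a b, γ t ∈ modelDomain Q) :
    ENNReal.ofReal |Real.log (height Q (γ b)) - Real.log (height Q (γ a))| ≤
      pathLen (catlinMetric (modelFun Q) p.totalDegree) γ a b := by
  have hf : ContDiffOn ℝ 1 (fun q => Real.log (height Q q)) (modelDomain Q) :=
    ((contDiff_modelFun hQ).neg.contDiffOn).log fun q hq => (height_pos hq).ne'
  have h1 := (h.comp_left hf hΩ).enorm_sub_le_mul_pathLen (C := 1) (γ := γ)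
    (F := catlinMetric (modelFun Q) p.totalDegree) zero_le_one (by
      filter_upwards [h.ae_differentiableAt] with t ht hmem
      have hh := height_pos (hΩ t hmem)
      rw [((hasDerivAt_height hQ (ht hmem)).log hh.ne').deriv, one_mul, norm_div, norm_neg,
        Real.norm_of_nonneg hh.le, div_le_iff₀ hh, mul_comm]
      exact (Complex.abs_re_le_norm _).trans (norm_normalPart_le hQ (hΩ t hmem) _))
  rw [ENNReal.ofReal_one, one_mul, ← ofReal_norm] at h1
  exact h1

theorem ofReal_abs_log_height_le {q q' : ℂ × ℂ} :
    ENNReal.ofReal |Real.log (height Q q') - Real.log (height Q q)| ≤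
      finslerEDist (modelDomain Q) (catlinMetric (modelFun Q) p.totalDegree) q q' := by
  refine le_of_forall_gt fun c hc => ?_
  obtain ⟨γ, h1, h2, rfl, rfl, h5⟩ := exists_path_of_finslerEDist_lt hc
  exact (abs_log_height_sub_le hQ h1 h2).trans_lt h5

/-- Along a curve of bounded length the height stays bounded. -/
theorem height_le_of_pathLen_lt {γ : ℝ → ℂ × ℂ} (h : PC1 γ 0 1)
    (hΩ : ∀ t ∈ Icc (0 : ℝ) 1, γ t ∈ modelDomain Q) {R : ℝ}
    (hR : pathLen (catlinMetric (modelFun Q) p.totalDegree) γ 0 1 ≤ ENNReal.ofReal R) (hR0 : 0 ≤ R)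
    {t : ℝ} (ht : t ∈ Icc (0 : ℝ) 1) : height Q (γ t) ≤ height Q (γ 0) * Real.exp R := by
  have h1 := abs_log_height_sub_le hQ (h.split ht.1 ht.2).1
    fun s hs => hΩ s ⟨hs.1, hs.2.trans ht.2⟩
  have h2 : pathLen (catlinMetric (modelFun Q) p.totalDegree) γ 0 t ≤ ENNReal.ofReal R := by
    rw [← pathLen_add ht.1 ht.2] at hR
    exact le_self_add.trans hR
  have h3 := (abs_le.1 ((ENNReal.ofReal_le_ofReal_iff hR0).1 (h1.trans h2))).2
  have p0 := height_pos (hΩ 0 ⟨le_rfl, zero_le_one⟩)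
  have pt := height_pos (hΩ t ht)
  rw [← Real.exp_log pt, ← Real.exp_log p0, ← Real.exp_add]
  exact Real.exp_le_exp.2 (by linarith)

/-- A curve of length below `2` stays at height at most `exp 2` times the initial one, so
`levelMetric_le` contracts it uniformly. -/
theorem levelEDist_le (h2 : 2 ≤ p.totalDegree) {q q' : ℂ × ℂ} (hq : q ∈ modelDomain Q)
    (hd : finslerEDist (modelDomain Q) (catlinMetric (modelFun Q) p.totalDegree) q q' ≤ 1) {T : ℝ}
    (hT : height Q q * Real.exp 2 ≤ T) :
    levelEDist p T q q' ≤
      ENNReal.ofReal (2 * (height Q q * Real.exp 2 / T) ^ (1 / (p.totalDegree : ℝ))) := by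
  obtain ⟨γ, h1, hΩ, rfl, rfl, h5⟩ := exists_path_of_finslerEDist_lt
    (hd.trans_lt (show (1 : ℝ≥0∞) < 2 by norm_num))
  have hlen : pathLen (catlinMetric (modelFun Q) p.totalDegree) γ 0 1 ≤ ENNReal.ofReal 2 := by
    simpa using h5.le
  have p0 := height_pos hq
  have hTp : 0 < T := lt_of_lt_of_le (by positivity) hT
  refine (finslerEDist_le (levelMetric_smul p T) h1 fun _ _ => mem_univ _).trans
    ((pathLen_le_mul (F' := catlinMetric (modelFun Q) p.totalDegree) (γ' := γ)
      (C := (height Q (γ 0) * Real.exp 2 / T) ^ (1 / (p.totalDegree : ℝ))) (by positivity)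
      (.of_forall fun t ht => ?_)).trans ?_)
  · have hle := height_le_of_pathLen_lt hQ h1 hΩ hlen zero_le_two ht
    have pt := height_pos (hΩ t ht)
    refine (levelMetric_le hQ h2 (hΩ t ht) (hle.trans hT) _).trans
      (mul_le_mul_of_nonneg_right ?_ (catlinMetric_nonneg hQ (hΩ t ht) _))
    gcongr
  · rw [mul_comm 2, ENNReal.ofReal_mul (by positivity)]
    gcongr

omit hQ in
/-- The point at height `T` on the vertical line through `q`. -/
noncomputable def raise (Q : ℂ → ℝ) (T : ℝ) (q : ℂ × ℂ) : ℂ × ℂ :=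
  (q.1, ((-T - Q q.1 : ℝ) : ℂ) + (q.2.im : ℂ) * Complex.I)

omit hQ in
theorem height_raise (T : ℝ) (q : ℂ × ℂ) : height Q (raise Q T q) = T := by
  simp [height, raise, modelFun]

omit hQ in
theorem raise_mem {T : ℝ} (hT : 0 < T) (q : ℂ × ℂ) : raise Q T q ∈ modelDomain Q := by
  simpa [modelDomain, modelFun, raise] using hT

theorem finslerEDist_raise_le {q : ℂ × ℂ} (hq : q ∈ modelDomain Q) {T : ℝ} (hT : 0 < T) :
    finslerEDist (modelDomain Q) (catlinMetric (modelFun Q) p.totalDegree) q (raise Q T q) ≤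
      ENNReal.ofReal |Real.log T - Real.log (height Q q)| := by
  have hh := height_pos hq
  set s := Real.log T - Real.log (height Q q) with hs
  -- The vertical line, parametrised so that the height is `h * exp (t * s)` and the Catlin speed is
  -- constantly `|s|`.
  set γ : ℝ → ℂ × ℂ := fun t => (q.1, q.2 + ((height Q q - height Q q * Real.exp (t * s) : ℝ) : ℂ))
    with hγ
  have hd : ∀ t, HasDerivAt γ (0, ((-(height Q q * (Real.exp (t * s) * s)) : ℝ) : ℂ)) t := fun t => by
    have h1 : HasDerivAt (fun t : ℝ => height Q q - height Q q * Real.exp (t * s))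
        (-(height Q q * (Real.exp (t * s) * s))) t := by
      have := (((hasDerivAt_id t).mul_const s).exp.const_mul (height Q q)).const_sub (height Q q)
      simpa using this
    exact (hasDerivAt_const t q.1).prodMk (h1.ofReal_comp.const_add q.2)
  have hγc : ContDiff ℝ 1 γ := by
    have : ContDiff ℝ 1 fun t : ℝ => height Q q - height Q q * Real.exp (t * s) := by fun_prop
    exact contDiff_const.prodMk (contDiff_const.add (Complex.ofRealCLM.contDiff.comp this))
  have hht : ∀ t, height Q (γ t) = height Q q * Real.exp (t * s) := fun t => by
    simp only [hγ, height, modelFun, Complex.add_re, Complex.ofReal_re]; ring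
  have hmem : ∀ t, γ t ∈ modelDomain Q := fun t => by
    have : 0 < height Q (γ t) := by rw [hht]; positivity
    exact neg_pos.1 this
  have h1 := finslerEDist_le (catlinMetric_smul hQ)
    (PC1.of_contDiffOn zero_le_one hγc.contDiffOn) (fun t _ => hmem t)
  have e0 : γ 0 = q := by simp [hγ]
  have e1 : γ 1 = raise Q T q := by
    have : height Q q * Real.exp s = T := by
      rw [hs, Real.exp_sub, Real.exp_log hT, Real.exp_log hh]; field_simp
    simp only [hγ, one_mul, this, raise]
    refine Prod.ext rfl ?_
    apply Complex.ext <;> simp [height, modelFun]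
    ring
  rw [e0, e1] at h1
  refine h1.trans ?_
  have hF : ∀ t, catlinMetric (modelFun Q) p.totalDegree (γ t) (deriv γ t) = |s| := fun t => by
    rw [catlinMetric_eq hQ (hmem t), (hd t).deriv, hht]
    simp only [normalPart, mul_zero, add_zero, norm_zero, zero_mul, Complex.norm_real, norm_neg,
      norm_mul, Real.norm_eq_abs, abs_of_pos hh, abs_of_pos (Real.exp_pos _)]
    field_simp
  simp [pathLen, hF]

/-- A curve lifted to the level `T` has constant height, so its normal part is purely imaginary and
equals `i` times the imaginary part for the original curve. The Catlin speed of the lift is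
therefore the level speed. -/
theorem finslerEDist_raise_raise_le {T : ℝ} (hT : 0 < T) (q q' : ℂ × ℂ) :
    finslerEDist (modelDomain Q) (catlinMetric (modelFun Q) p.totalDegree) (raise Q T q)
      (raise Q T q') ≤ levelEDist p T q q' := by
  refine le_of_forall_gt fun c hc => ?_
  obtain ⟨γ, h1, -, rfl, rfl, h5⟩ := exists_path_of_finslerEDist_lt hc
  have hr : ContDiff ℝ 1 (raise Q T) :=
    contDiff_fst.prodMk ((Complex.ofRealCLM.contDiff.comp
      (contDiff_const.sub ((contDiff_model hQ).comp contDiff_fst))).add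
      ((Complex.ofRealCLM.contDiff.comp (Complex.imCLM.contDiff.comp contDiff_snd)).mul
        contDiff_const))
  have h2 := finslerEDist_le (catlinMetric_smul hQ)
    (h1.comp_left hr.contDiffOn fun t _ => mem_univ _) (fun t _ => raise_mem hT (γ t))
  refine (h2.trans ((pathLen_le_mul (F' := levelMetric p T) (γ' := γ) zero_le_one ?_).trans_eq
    (by simp))).trans_lt h5
  filter_upwards [h1.ae_differentiableAt] with t ht hmem
  have hγ := (ht hmem).hasDerivAt
  have hγ1 : HasDerivAt (fun t => (γ t).1) (deriv γ t).1 t :=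
    (ContinuousLinearMap.fst ℝ ℂ ℂ).hasFDerivAt.comp_hasDerivAt t hγ
  have hγ2 : HasDerivAt (fun t => (γ t).2.im) (deriv γ t).2.im t :=
    (Complex.imCLM.comp (ContinuousLinearMap.snd ℝ ℂ ℂ)).hasFDerivAt.comp_hasDerivAt t hγ
  have hQ' : HasDerivAt (fun t => -T - Q (γ t).1)
      (-(2 * evalConj (MvPolynomial.pderiv 0 p) (γ t).1 * (deriv γ t).1).re) t :=
    (((hasFDerivAt_model hQ (γ t).1).comp_hasDerivAt t hγ1).const_sub (-T)).congr_deriv (by simp)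
  have hd : HasDerivAt (fun t => raise Q T (γ t)) _ t :=
    hγ1.prodMk (hQ'.ofReal_comp.add (hγ2.ofReal_comp.mul_const Complex.I))
  rw [hd.deriv, catlinMetric_eq hQ (raise_mem hT _), height_raise, one_mul, levelMetric]
  refine le_of_eq ?_
  congr 2
  -- The factor `‖I‖ = 1` is inserted to exhibit the normal part as a real multiple of `I`.
  rw [← Real.norm_eq_abs, ← Complex.norm_real, ← mul_one ‖((_ : ℝ) : ℂ)‖, ← Complex.norm_I,
    ← norm_mul]
  congr 1
  apply Complex.ext <;> simp [normalPart, raise]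

theorem finslerEDist_le_levelEDist {q q' : ℂ × ℂ} (hq : q ∈ modelDomain Q)
    (hq' : q' ∈ modelDomain Q) {T : ℝ} (hT : 0 < T) :
    finslerEDist (modelDomain Q) (catlinMetric (modelFun Q) p.totalDegree) q q' ≤
      ENNReal.ofReal |Real.log T - Real.log (height Q q)| +
      ENNReal.ofReal |Real.log T - Real.log (height Q q')| + levelEDist p T q q' := by
  have hF := catlinMetric_smul hQ
  have h1 := finslerEDist_triangle (Ω := modelDomain Q) hF q (raise Q T q) q'
  have h2 := finslerEDist_triangle (Ω := modelDomain Q) hF (raise Q T q) (raise Q T q') q'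
  have h3 := finslerEDist_raise_le hQ hq hT
  have h4 := finslerEDist_raise_le hQ hq' hT
  rw [finslerEDist_comm hF] at h4
  have h5 := finslerEDist_raise_raise_le hQ hT q q'
  calc _ ≤ _ := h1
    _ ≤ _ := add_le_add h3 (h2.trans (add_le_add h5 h4))
    _ = _ := by ring

theorem finslerEDist_ne_top {q q' : ℂ × ℂ} (hq : q ∈ modelDomain Q) (hq' : q' ∈ modelDomain Q) :
    finslerEDist (modelDomain Q) (catlinMetric (modelFun Q) p.totalDegree) q q' ≠ ∞ :=
  ne_top_of_le_ne_top (by simp [levelEDist_ne_top p one_pos])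
    (finslerEDist_le_levelEDist hQ hq hq' one_pos)

end Model

end CatlinModel

/-! ### Comparison with the Euclidean distance -/

namespace CatlinModel

open MeasureTheory Set Filter Topology

section Model

variable {Q : ℂ → ℝ} {p : MvPolynomial (Fin 2) ℂ} (hQ : ∀ z, (Q z : ℂ) = evalConj p z)
include hQ

/-- The metric is bounded by a continuous multiple `U` of the norm; integrating along a segment in a
small ball gives the bound. -/
theorem exists_finslerEDist_le_norm_sub {q₀ : ℂ × ℂ} (h₀ : q₀ ∈ modelDomain Q) :
    ∃ C δ : ℝ, 0 < C ∧ 0 < δ ∧ ∀ q, ‖q - q₀‖ < δ → q ∈ modelDomain Q ∧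
      finslerEDist (modelDomain Q) (catlinMetric (modelFun Q) p.totalDegree) q₀ q ≤
        ENNReal.ofReal (C * ‖q - q₀‖) := by
  set g : ℂ → ℂ := evalConj (MvPolynomial.pderiv 0 p) with hg
  have hgc : Continuous g := (contDiff_evalConj _).continuous
  set U : ℂ × ℂ → ℝ := fun q =>
    (1 + 2 * ‖g q.1‖) / height Q q + horizontalCoeff p q.1 (height Q q) with hU
  have hhc : Continuous (height Q) := (contDiff_modelFun hQ).continuous.neg
  have hUc : ContinuousAt U q₀ := by
    have h1 : Continuous fun q : ℂ × ℂ => 1 + 2 * ‖g q.1‖ := by fun_prop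
    exact (h1.continuousAt.div hhc.continuousAt (height_pos h₀).ne').add
      (continuousAt_horizontalCoeff p continuousAt_fst hhc.continuousAt (height_pos h₀).ne')
  have hU0 : 0 ≤ U q₀ := by
    have := height_pos h₀
    have := horizontalCoeff_nonneg p q₀.1 this.le
    positivity
  have hFU : ∀ q ∈ modelDomain Q, ∀ v,
      catlinMetric (modelFun Q) p.totalDegree q v ≤ U q * ‖v‖ := by
    intro q hq v
    have hh := height_pos hq
    rw [catlinMetric_eq hQ hq, hU, add_mul]
    have hn : ‖normalPart p q v‖ ≤ (1 + 2 * ‖g q.1‖) * ‖v‖ := by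
      refine (norm_add_le _ _).trans ?_
      rw [norm_mul, norm_mul, Complex.norm_ofNat]
      have h1 := norm_fst_le v
      have h2 := norm_snd_le v
      have := mul_le_mul_of_nonneg_left h1 (show 0 ≤ 2 * ‖g q.1‖ by positivity)
      rw [← hg]
      linarith
    refine add_le_add ?_ ?_
    · rw [div_mul_eq_mul_div]
      gcongr
    · rw [mul_comm]
      exact mul_le_mul_of_nonneg_left (norm_fst_le v) (horizontalCoeff_nonneg p q.1 hh.le)
  obtain ⟨δ, hδ, hball⟩ := Metric.mem_nhds_iff.1 (Filter.inter_mem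
    (hUc.eventually_lt continuousAt_const (show U q₀ < U q₀ + 1 by linarith))
    ((isOpen_modelDomain hQ).mem_nhds h₀))
  refine ⟨U q₀ + 1, δ, by linarith, hδ, fun q hq => ?_⟩
  have hmem : ∀ t ∈ Icc (0 : ℝ) 1, q₀ + t • (q - q₀) ∈ Metric.ball q₀ δ := by
    intro t ht
    rw [mem_ball_iff_norm, add_sub_cancel_left, norm_smul, Real.norm_of_nonneg ht.1]
    exact (mul_le_of_le_one_left (norm_nonneg _) ht.2).trans_lt hq
  have e1 : q₀ + (1 : ℝ) • (q - q₀) = q := by simp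
  refine ⟨e1 ▸ (hball (hmem 1 ⟨zero_le_one, le_rfl⟩)).2, ?_⟩
  set γ : ℝ → ℂ × ℂ := fun t => q₀ + t • (q - q₀) with hγ
  have hd : ∀ t, deriv γ t = q - q₀ := fun t => by
    have h : HasDerivAt γ ((1 : ℝ) • (q - q₀)) t :=
      ((hasDerivAt_id t).smul_const (q - q₀)).const_add q₀
    rw [h.deriv, one_smul]
  have hγc : ContDiff ℝ 1 γ := by fun_prop
  have h1 := finslerEDist_le (catlinMetric_smul hQ)
    (PC1.of_contDiffOn zero_le_one hγc.contDiffOn) (fun t ht => (hball (hmem t ht)).2)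
  have e0 : γ 0 = q₀ := by simp [hγ]
  rw [e0, show γ 1 = q from e1] at h1
  refine h1.trans ?_
  unfold pathLen
  refine (setLIntegral_mono' (g := fun _ => ENNReal.ofReal ((U q₀ + 1) * ‖q - q₀‖))
    measurableSet_Icc fun t ht => ENNReal.ofReal_le_ofReal ?_).trans (by simp)
  rw [hd]
  exact (hFU _ (hball (hmem t ht)).2 _).trans
    (mul_le_mul_of_nonneg_right (hball (hmem t ht)).1.le (norm_nonneg _))

/-- Curves of length below `R` stay below height `H`, where the horizontal coefficient is at least
`1/k`. This controls the `z` component, hence confines `z` to a disc on which `∂Q/∂z` is bounded,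
and then the normal part controls the `w` component. -/
theorem exists_norm_sub_le_finslerEDist (h2 : 2 ≤ p.totalDegree) {c : ℝ} (hc : 0 < c)
    (hcz : ∀ z, c ≤ mixedMax p p.totalDegree z) {q₀ : ℂ × ℂ} (h₀ : q₀ ∈ modelDomain Q) {R : ℝ}
    (hR : 0 ≤ R) : ∃ C : ℝ, 0 < C ∧ ∀ q,
      finslerEDist (modelDomain Q) (catlinMetric (modelFun Q) p.totalDegree) q₀ q <
        ENNReal.ofReal R →
      ‖q - q₀‖ₑ ≤ ENNReal.ofReal C *
        finslerEDist (modelDomain Q) (catlinMetric (modelFun Q) p.totalDegree) q₀ q := by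
  set H := height Q q₀ * Real.exp R with hH
  have hHpos : 0 < H := mul_pos (height_pos h₀) (Real.exp_pos _)
  set k := (H / c) ^ (1 / (p.totalDegree : ℝ)) with hk
  have hkpos : 0 < k := by positivity
  set g : ℂ → ℂ := evalConj (MvPolynomial.pderiv 0 p) with hg
  have hgc : Continuous g := (contDiff_evalConj _).continuous
  obtain ⟨G, hG⟩ := (isCompact_closedBall q₀.1 (k * R)).exists_bound_of_continuousOn hgc.continuousOn
  have hG0 : 0 ≤ G := (norm_nonneg _).trans (hG q₀.1 (Metric.mem_closedBall_self (by positivity)))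
  have hfst : ∀ q ∈ modelDomain Q, height Q q ≤ H → ∀ v,
      ‖v.1‖ ≤ k * catlinMetric (modelFun Q) p.totalDegree q v := by
    intro q hq hqH v
    have hh := height_pos hq
    have h1 := le_horizontalCoeff p h2 hc (hcz q.1) hh
    have h3 : 1 ≤ k * (c / height Q q) ^ (1 / (p.totalDegree : ℝ)) := by
      rw [hk, ← Real.mul_rpow (by positivity) (by positivity)]
      refine Real.one_le_rpow ?_ (by positivity)
      rw [div_mul_div_cancel₀ hc.ne', le_div_iff₀ hh, one_mul]
      exact hqH
    rw [catlinMetric_eq hQ hq]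
    calc ‖v.1‖ ≤ ‖v.1‖ * (k * (c / height Q q) ^ (1 / (p.totalDegree : ℝ))) :=
          le_mul_of_one_le_right (norm_nonneg _) h3
      _ = k * (‖v.1‖ * (c / height Q q) ^ (1 / (p.totalDegree : ℝ))) := by ring
      _ ≤ k * (‖v.1‖ * horizontalCoeff p q.1 (height Q q)) := by gcongr
      _ ≤ _ := by
        refine mul_le_mul_of_nonneg_left (le_add_of_nonneg_left ?_) hkpos.le
        positivity
  -- The `z` speed is at most `k` and the `w` speed at most `H + 2 * G * k` times the Catlin speed;
  -- the sum dominates the sup norm.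
  refine ⟨k + (H + 2 * G * k), by positivity, fun q hq => ?_⟩
  have hCpos : 0 < k + (H + 2 * G * k) := by positivity
  rw [mul_comm]
  refine (ENNReal.div_le_iff (by simpa using hCpos) ENNReal.ofReal_ne_top).1
    (le_of_forall_gt fun e he => ?_)
  obtain ⟨γ, h1, hΩ, rfl, rfl, h5⟩ := exists_path_of_finslerEDist_lt (lt_min he hq)
  refine lt_of_le_of_lt ?_ (h5.trans_le (min_le_left _ _))
  have hlen := (h5.trans_le (min_le_right _ _)).le
  refine ENNReal.div_le_of_le_mul ?_
  rw [mul_comm]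
  have hheight : ∀ t ∈ Icc (0 : ℝ) 1, height Q (γ t) ≤ H := fun t ht =>
    height_le_of_pathLen_lt hQ h1 hΩ hlen hR ht
  have hz : ∀ t ∈ Icc (0 : ℝ) 1, ‖(γ t).1 - (γ 0).1‖ ≤ k * R := by
    intro t ht
    have hsplit := (h1.split ht.1 ht.2).1
    have h6 := (hsplit.comp_left (f := Prod.fst) contDiff_fst.contDiffOn
      fun _ _ => mem_univ _).enorm_sub_le_mul_pathLen (γ := γ)
      (F := catlinMetric (modelFun Q) p.totalDegree) hkpos.le (by
        filter_upwards [hsplit.ae_differentiableAt] with s hs hmem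
        have hs1 : s ∈ Icc (0 : ℝ) 1 := ⟨hmem.1, hmem.2.trans ht.2⟩
        have hγ1 : HasDerivAt (fun t => (γ t).1) (deriv γ s).1 s :=
          (ContinuousLinearMap.fst ℝ ℂ ℂ).hasFDerivAt.comp_hasDerivAt s (hs hmem).hasDerivAt
        rw [hγ1.deriv]
        exact hfst _ (hΩ s hs1) (hheight s hs1) _)
    have h7 : pathLen (catlinMetric (modelFun Q) p.totalDegree) γ 0 t ≤ ENNReal.ofReal R := by
      rw [← pathLen_add ht.1 ht.2] at hlen
      exact le_self_add.trans hlen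
    have h8 := h6.trans (mul_le_mul_right h7 (ENNReal.ofReal k))
    rw [← ENNReal.ofReal_mul hkpos.le, ← ofReal_norm] at h8
    exact (ENNReal.ofReal_le_ofReal_iff (by positivity)).1 h8
  refine h1.enorm_sub_le_mul_pathLen (by positivity) (.of_forall fun t ht => ?_)
  set v := deriv γ t with hv
  have f1 := hfst _ (hΩ t ht) (hheight t ht) v
  have f0 := catlinMetric_nonneg hQ (hΩ t ht) v
  have f2 := norm_normalPart_le hQ (hΩ t ht) v
  have f3 := hG (γ t).1 (by rw [Metric.mem_closedBall, dist_eq_norm]; exact hz t ht)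
  set f := catlinMetric (modelFun Q) p.totalDegree (γ t) v
  have f4 : ‖v.2‖ ≤ ‖normalPart p (γ t) v‖ + 2 * G * ‖v.1‖ := by
    have e : v.2 = normalPart p (γ t) v - 2 * g (γ t).1 * v.1 := by simp [normalPart, hg]
    calc ‖v.2‖ = ‖normalPart p (γ t) v - 2 * g (γ t).1 * v.1‖ := by rw [← e]
      _ ≤ ‖normalPart p (γ t) v‖ + ‖2 * g (γ t).1 * v.1‖ := norm_sub_le _ _
      _ ≤ _ := by
        rw [norm_mul, norm_mul, Complex.norm_ofNat]
        gcongr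
  have f5 : ‖normalPart p (γ t) v‖ ≤ H * f :=
    f2.trans (mul_le_mul_of_nonneg_right (hheight t ht) f0)
  have f6 : 2 * G * ‖v.1‖ ≤ 2 * G * (k * f) := by gcongr
  rw [Prod.norm_def]
  refine max_le ?_ ?_
  · have : 0 ≤ (H + 2 * G * k) * f := by positivity
    linarith
  · have : 0 ≤ k * f := by positivity
    linarith

end Model

/-! ### The Catlin metric space: properness, geodesics, level family -/

theorem properSpace_of_subset_image {X Y : Type*} [MetricSpace X] [TopologicalSpace Y]
    (h : ∀ (x : X) (R : ℝ), ∃ (K : Set Y) (g : Y → X), IsCompact K ∧ ContinuousOn g K ∧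
      Metric.closedBall x R ⊆ g '' K) : ProperSpace X :=
  ⟨fun x R => by
    obtain ⟨K, g, hK, hg, hsub⟩ := h x R
    exact (hK.image_of_continuousOn hg).of_isClosed_subset Metric.isClosed_closedBall hsub⟩

/-- The model domain, without the metric inherited from `ℂ²`. -/
def CatlinSpace (Q : ℂ → ℝ) : Type := modelDomain Q

/-- The inclusion of the model domain in `ℂ²`. -/
def CatlinSpace.val {Q : ℂ → ℝ} (x : CatlinSpace Q) : ℂ × ℂ := Subtype.val x

theorem CatlinSpace.val_mem {Q : ℂ → ℝ} (x : CatlinSpace Q) : x.val ∈ modelDomain Q :=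
  Subtype.property x

/-- The distance of the Catlin metric. -/
noncomputable def catlinEDist (Q : ℂ → ℝ) (p : MvPolynomial (Fin 2) ℂ) : ℂ × ℂ → ℂ × ℂ → ℝ≥0∞ :=
  finslerEDist (modelDomain Q) (catlinMetric (modelFun Q) p.totalDegree)

section Space

variable {Q : ℂ → ℝ} {p : MvPolynomial (Fin 2) ℂ}

theorem catlinEDist_eq_zero (hQ : ∀ z, (Q z : ℂ) = evalConj p z) (h2 : 2 ≤ p.totalDegree) {c : ℝ}
    (hc : 0 < c) (hcz : ∀ z, c ≤ mixedMax p p.totalDegree z) {q q' : ℂ × ℂ}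
    (hq : q ∈ modelDomain Q) (h : catlinEDist Q p q q' = 0) : q = q' := by
  obtain ⟨C, -, hC⟩ := exists_norm_sub_le_finslerEDist hQ h2 hc hcz hq zero_le_one
  unfold catlinEDist at h
  have := hC q' (by rw [h]; simp)
  rw [h, mul_zero, nonpos_iff_eq_zero, enorm_eq_zero, sub_eq_zero] at this
  exact this.symm

/-- The metric space defined by the Catlin metric. -/
@[reducible] noncomputable def catlinMetricSpace (hQ : ∀ z, (Q z : ℂ) = evalConj p z)
    (h2 : 2 ≤ p.totalDegree) {c : ℝ} (hc : 0 < c) (hcz : ∀ z, c ≤ mixedMax p p.totalDegree z) :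
    MetricSpace (CatlinSpace Q) :=
  letI : EMetricSpace (CatlinSpace Q) :=
    { edist := fun x y => catlinEDist Q p x.val y.val
      edist_self := fun x => finslerEDist_self (catlinMetric_smul hQ) x.val_mem
      edist_comm := fun x y => finslerEDist_comm (catlinMetric_smul hQ) x.val y.val
      edist_triangle := fun x y z =>
        finslerEDist_triangle (catlinMetric_smul hQ) x.val y.val z.val
      eq_of_edist_eq_zero := fun {x _} h =>
        Subtype.ext (catlinEDist_eq_zero hQ h2 hc hcz x.val_mem h) }
  EMetricSpace.toMetricSpace fun x y => finslerEDist_ne_top hQ x.val_mem y.val_mem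

variable [MetricSpace (CatlinSpace Q)]
  (hE : ∀ x y : CatlinSpace Q, edist x y = catlinEDist Q p x.val y.val)
  (hQ : ∀ z, (Q z : ℂ) = evalConj p z)
include hE hQ

theorem abs_log_height_sub_le_dist (x y : CatlinSpace Q) :
    |Real.log (height Q y.val) - Real.log (height Q x.val)| ≤ dist x y := by
  have h := ofReal_abs_log_height_le hQ (q := x.val) (q' := y.val)
  change _ ≤ catlinEDist Q p x.val y.val at h
  rw [← hE, edist_dist] at h
  exact (ENNReal.ofReal_le_ofReal_iff dist_nonneg).1 h

theorem CatlinSpace.continuousOn_of_val_eq {K : Set (ℂ × ℂ)} {g : ℂ × ℂ → CatlinSpace Q}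
    (hg : ∀ q ∈ K, (g q).val = q) : ContinuousOn g K := by
  intro q hq
  obtain ⟨C, δ, hC, hδ, h⟩ := exists_finslerEDist_le_norm_sub hQ (hg q hq ▸ (g q).val_mem)
  refine Metric.continuousWithinAt_iff.2 fun ε hε => ⟨min δ (ε / C), by positivity, ?_⟩
  intro q' hq' hd
  rw [dist_eq_norm] at hd
  have h1 := (h q' (hd.trans_le (min_le_left _ _))).2
  change catlinEDist Q p q q' ≤ _ at h1
  rw [← hg q hq, ← hg q' hq', ← hE, edist_dist, hg q hq, hg q' hq',
    ENNReal.ofReal_le_ofReal_iff (by positivity)] at h1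
  rw [dist_comm]
  refine h1.trans_lt ?_
  rw [← lt_div_iff₀' hC]
  exact hd.trans_le (min_le_right _ _)

/-- A ball lies over a Euclidean ball cut off at a positive height, which is compact in `ℂ²` and
avoids the boundary; its inclusion is continuous for the Catlin distance. -/
theorem CatlinSpace.properSpace (h2 : 2 ≤ p.totalDegree) {c : ℝ}
    (hc : 0 < c) (hcz : ∀ z, c ≤ mixedMax p p.totalDegree z) : ProperSpace (CatlinSpace Q) := by
  classical
  refine properSpace_of_subset_image (Y := ℂ × ℂ) fun x R => ?_
  rcases lt_or_ge R 0 with hR | hR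
  · exact ⟨∅, fun _ => x, isCompact_empty, continuousOn_empty _, by
      rw [Metric.closedBall_eq_empty.2 hR]; exact empty_subset _⟩
  obtain ⟨C, hC0, hC⟩ := exists_norm_sub_le_finslerEDist hQ h2 hc hcz x.val_mem
    (show 0 ≤ R + 1 by linarith)
  set m := height Q x.val * Real.exp (-R) with hm
  have hmpos : 0 < m := mul_pos (height_pos x.val_mem) (Real.exp_pos _)
  set K : Set (ℂ × ℂ) := Metric.closedBall x.val (C * R) ∩ {q | m ≤ height Q q} with hK
  have hKsub : K ⊆ modelDomain Q := fun q hq => neg_pos.1 (hmpos.trans_le hq.2)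
  set g : ℂ × ℂ → CatlinSpace Q := fun q => if h : q ∈ modelDomain Q then ⟨q, h⟩ else x with hg
  have hval : ∀ q ∈ modelDomain Q, (g q).val = q := fun q hq =>
    congrArg CatlinSpace.val (dif_pos hq)
  refine ⟨K, g, (isCompact_closedBall _ _).inter_right
    (isClosed_le continuous_const (contDiff_modelFun hQ).continuous.neg),
    CatlinSpace.continuousOn_of_val_eq hE hQ fun q hq => hval q (hKsub hq), fun y hy => ?_⟩
  rw [Metric.mem_closedBall, dist_comm] at hy
  refine ⟨y.val, ⟨?_, ?_⟩, Subtype.ext (hval y.val y.val_mem)⟩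
  · have hdist : finslerEDist (modelDomain Q) (catlinMetric (modelFun Q) p.totalDegree) x.val y.val
        = ENNReal.ofReal (dist x y) := by
      rw [← edist_dist, hE]; rfl
    have h1 := hC y.val (by
      rw [hdist]
      exact (ENNReal.ofReal_lt_ofReal_iff (by linarith)).2 (by linarith))
    rw [hdist, ← ENNReal.ofReal_mul hC0.le, ← ofReal_norm,
      ENNReal.ofReal_le_ofReal_iff (by positivity)] at h1
    rw [mem_closedBall_iff_norm]
    exact h1.trans (by gcongr)
  · have h1 := (abs_le.1 (abs_log_height_sub_le_dist hE hQ x y)).1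
    have px := height_pos x.val_mem
    have py := height_pos y.val_mem
    change m ≤ height Q y.val
    rw [hm, ← Real.exp_log py]
    nth_rewrite 1 [← Real.exp_log px]
    rw [← Real.exp_add]
    exact Real.exp_le_exp.2 (by linarith)

theorem CatlinSpace.exists_geodesic [ProperSpace (CatlinSpace Q)] (x y : CatlinSpace Q) :
    ∃ S, IsGeodesicSegment x y S := by
  refine isGeodesicSegment_exists_of_approx fun ε hε => ?_
  rcases eq_or_ne x y with rfl | hxy
  · refine ⟨fun _ => x, rfl, rfl, fun s _ t _ => ?_⟩
    rw [dist_self]; positivity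
  have hpos : 0 < dist x y := dist_pos.2 hxy
  have hlt : finslerEDist (modelDomain Q) (catlinMetric (modelFun Q) p.totalDegree) x.val y.val <
      ENNReal.ofReal (dist x y + ε) := by
    change catlinEDist Q p x.val y.val < _
    rw [← hE, edist_dist]
    exact (ENNReal.ofReal_lt_ofReal_iff (by linarith)).2 (by linarith)
  obtain ⟨γ, h1, hΩ, h0, h1', h5⟩ := exists_path_of_finslerEDist_lt hlt
  have hL := (h5.trans ENNReal.ofReal_lt_top).ne
  obtain ⟨τ, hτ0, hτ1, hτ⟩ := exists_proportional_points hL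
  have hmem : ∀ s ∈ Icc 0 (dist x y), s / dist x y ∈ Icc (0 : ℝ) 1 := fun s hs =>
    ⟨div_nonneg hs.1 hpos.le, (div_le_one hpos).2 hs.2⟩
  classical
  -- A curve of length below `dist x y + ε`, run proportionally to its length; the default `x` is
  -- never taken on the interval in question.
  set σ : ℝ → CatlinSpace Q := fun s =>
    if h : γ (τ (s / dist x y)) ∈ modelDomain Q then ⟨γ (τ (s / dist x y)), h⟩ else x with hσ
  have hval : ∀ s ∈ Icc 0 (dist x y), (σ s).val = γ (τ (s / dist x y)) := fun s hs =>
    congrArg CatlinSpace.val (dif_pos (hΩ _ (hτ _ (hmem s hs)).1))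
  have key : ∀ s ∈ Icc 0 (dist x y), ∀ t ∈ Icc 0 (dist x y), s ≤ t →
      dist (σ s) (σ t) ≤ |t - s| + ε := by
    intro s hs t ht hst
    have ms := hmem s hs
    have mt := hmem t ht
    have hle : s / dist x y ≤ t / dist x y := by gcongr
    have h6 := finslerEDist_le_of_proportional (catlinMetric_smul hQ) h1 hΩ hL (hτ _ ms).1
      (hτ _ mt).1 ms (hτ _ ms).2 (hτ _ mt).2 hle
    have h7 : edist (σ s) (σ t) ≤ ENNReal.ofReal (t / dist x y - s / dist x y) *
        ENNReal.ofReal (dist x y + ε) := by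
      rw [hE, hval s hs, hval t ht]
      exact h6.trans (mul_le_mul_right h5.le _)
    rw [edist_dist, ← ENNReal.ofReal_mul (sub_nonneg.2 hle),
      ENNReal.ofReal_le_ofReal_iff (mul_nonneg (sub_nonneg.2 hle) (by positivity))] at h7
    rw [abs_of_nonneg (sub_nonneg.2 hst)]
    refine h7.trans ?_
    rw [mul_add (t / dist x y - s / dist x y)]
    refine add_le_add (le_of_eq (by field_simp)) ?_
    exact mul_le_of_le_one_left hε.le (by linarith [ms.1, mt.2])
  refine ⟨σ, Subtype.ext ?_, Subtype.ext ?_, fun s hs t ht => ?_⟩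
  · have := hval 0 ⟨le_rfl, hpos.le⟩
    rw [zero_div, hτ0, h0] at this
    exact this
  · have := hval (dist x y) ⟨hpos.le, le_rfl⟩
    rw [div_self hpos.ne', hτ1, h1'] at this
    exact this
  · rcases le_total s t with hst | hst
    · exact key s hs t ht hst
    · rw [dist_comm, abs_sub_comm]
      exact key t ht s hs hst

/-- Log-height plays the role of the height, and the level `τ` is the level set of height `exp τ`;
the rate `1/m` is the exponent in `levelMetric_le`. -/
theorem CatlinSpace.levelFamily (h2 : 2 ≤ p.totalDegree) :
    LevelFamily (CatlinSpace Q) (fun x => Real.log (height Q x.val))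
      (fun τ x y => (levelEDist p (Real.exp τ) x.val y.val).toReal)
      (1 / (p.totalDegree : ℝ)) where
  pos := by positivity
  self τ x := by
    rw [levelEDist, finslerEDist_self (levelMetric_smul p _) (mem_univ _), ENNReal.toReal_zero]
  symm τ x y := by rw [levelEDist, finslerEDist_comm (levelMetric_smul p _)]; rfl
  triangle τ x y z := by
    have hfin := fun q q' => levelEDist_ne_top p (Real.exp_pos τ) q q'
    rw [← ENNReal.toReal_add (hfin _ _) (hfin _ _)]
    exact ENNReal.toReal_mono (ENNReal.add_ne_top.2 ⟨hfin _ _, hfin _ _⟩)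
      (finslerEDist_triangle (levelMetric_smul p _) _ _ _)
  height_le x y := by linarith [(abs_le.1 (abs_log_height_sub_le_dist hE hQ x y)).2]
  dist_le τ x y hx hy := by
    have h := finslerEDist_le_levelEDist hQ x.val_mem y.val_mem (Real.exp_pos τ)
    change catlinEDist Q p x.val y.val ≤ _ at h
    rw [← hE, edist_dist, Real.log_exp, abs_of_nonneg (sub_nonneg.2 hx),
      abs_of_nonneg (sub_nonneg.2 hy), ← ENNReal.ofReal_toReal (levelEDist_ne_top p (Real.exp_pos τ)
        x.val y.val), ← ENNReal.ofReal_add (sub_nonneg.2 hx) (sub_nonneg.2 hy),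
      ← ENNReal.ofReal_add (add_nonneg (sub_nonneg.2 hx) (sub_nonneg.2 hy)) ENNReal.toReal_nonneg]
      at h
    exact (ENNReal.ofReal_le_ofReal_iff (add_nonneg (add_nonneg (sub_nonneg.2 hx)
      (sub_nonneg.2 hy)) ENNReal.toReal_nonneg)).1 h
  le_of_dist_le τ x y hd hτ := by
    have px := height_pos x.val_mem
    have e : height Q x.val * Real.exp 2 / Real.exp τ =
        Real.exp (Real.log (height Q x.val) + 2 - τ) := by
      rw [Real.exp_sub, Real.exp_add, Real.exp_log px]
    have h := levelEDist_le hQ h2 x.val_mem (q' := y.val) (T := Real.exp τ) (by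
      change catlinEDist Q p x.val y.val ≤ 1
      rw [← hE, edist_dist]
      simpa using hd) (by
      nth_rewrite 1 [← Real.exp_log px]
      rw [← Real.exp_add]
      exact Real.exp_le_exp.2 hτ)
    rw [e, ← Real.exp_mul, mul_comm _ (1 / (p.totalDegree : ℝ))] at h
    exact ENNReal.toReal_le_of_le_ofReal (by positivity) h

end Space

end CatlinModel

theorem mainTheorem3 (Q : ℂ → ℝ) (p : MvPolynomial (Fin 2) ℂ)
    (hQ : CatlinModel.IsModelPolynomial Q p) (hQ0 : Q ≠ 0) :
    ∃ M : MetricSpace (CatlinModel.modelDomain Q),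
      (∀ x y : CatlinModel.modelDomain Q,
        @edist _ M.toEDist x y =
          CatlinModel.finslerEDist (CatlinModel.modelDomain Q)
            (CatlinModel.catlinMetric (CatlinModel.modelFun Q) p.totalDegree) x y) ∧
      @CatlinModel.IsGromovHyperbolic (CatlinModel.modelDomain Q) M := by
  have hp : p ≠ 0 := by
    rintro rfl
    refine hQ0 (funext fun z => ?_)
    have := hQ.eval_eq z
    rw [map_zero] at this
    exact_mod_cast this
  obtain ⟨h2, c, hc, hcz⟩ := CatlinModel.exists_le_mixedMax hp hQ.no_harmonic
  have hev : ∀ z, (Q z : ℂ) = CatlinModel.evalConj p z := hQ.eval_eq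
  -- The metric is built on the type copy `CatlinSpace Q`, where no Euclidean instance interferes,
  -- and is transported at the end by definitional equality.
  let M : MetricSpace (CatlinModel.CatlinSpace Q) :=
    CatlinModel.catlinMetricSpace hev h2 hc hcz
  have hE : ∀ x y : CatlinModel.CatlinSpace Q,
      edist x y = CatlinModel.catlinEDist Q p x.val y.val := fun _ _ => rfl
  have := CatlinModel.CatlinSpace.properSpace hE hev h2 hc hcz
  have hyp : CatlinModel.IsGromovHyperbolic (CatlinModel.CatlinSpace Q) :=
    CatlinModel.isGromovHyperbolic_of_levelFamily
      (CatlinModel.CatlinSpace.levelFamily hE hev h2)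
      (CatlinModel.CatlinSpace.exists_geodesic hE hev)
  exact ⟨M, hE, hyp⟩
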